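/- Let $X_1,X_2,\dots$ be real random variables on a probability space $(\Omega,\mathbf P)$ such that $\mathbf E X_iX_j=\delta_{ij}$ (Kronecker's symbol) for all $i,j\ge 1$, $\mathbf E X_j=0$ for all $j$, and $\sup_j \mathbf E|X_j|^3<\infty$. Suppose that $\frac{X_1^2+\cdots+X_n^2}{n}\to 1$ in probability as $n\to\infty$. For integers $1\le k\le n$ let $\mathcal G_{n,k}$ be the family of all $k$-element subsets $\tau$ of $\{1,\dots,n\}$ and let $\mu_{n,k}$ be the normalized counting measure on it. For $\tau\in\mathcal G_{n,k}$ let $F_\tau(x)=\mathbf P\{S_\tau\le x\}$, $x\in\mathbf R$, be the distribution function of $S_\tau=\frac1{\sqrt k}\sum_{i\in\tau}X_i$. Let $\Phi$ be the standard normal distribution function, and let $L(F,G)$ be the Lévy distance, the infimum of all $h\ge 0$ such that $G(x-h)-h\le F(x)\le G(x+h)+h$ for all $x\in\mathbf R$. Then there are real numbers $\varepsilon_{n,k}$ $(1\le k\le n)$, depending on the sequence $(X_j)$ but not on $\delta$, with $\varepsilon_{n,k}\to 0$ as $k\to\infty$ and $k/n\to 0$, such that for all $1\le k\le n$ and every $\delta>0$,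 $$\mu_{n,k}\bigl\{\tau\in\mathcal G_{n,k} : L(F_\tau,\Phi)\ge \delta+\varepsilon_{n,k}\bigr\}\le C\,k^{3/4}\exp(-c\,k\,\delta^8),$$ where $C$ and $c$ are positive absolute constants. -/

import Mathlib

open MeasureTheory ProbabilityTheory Filter Topology

noncomputable section

/-- The Lévy distance between two distribution functions on the line: the infimum of all `δ ≥ 0`
such that `G (x - δ) - δ ≤ F x ≤ G (x + δ) + δ` for all `x`. -/
def levyDist (F G : ℝ → ℝ) : ℝ :=
  sInf {δ : ℝ | 0 ≤ δ ∧ ∀ x : ℝ, G (x - δ) - δ ≤ F x ∧ F x ≤ G (x + δ) + δ}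

/-- The standard normal distribution function. -/
def stdNormalCDF (x : ℝ) : ℝ := cdf (gaussianReal 0 1) x

/-- The normalized sum `S_τ = (X_{i₁} + ⋯ + X_{i_k}) / √k` over a set `τ = {i₁, …, i_k}` of
`k` indices. -/
def normSum {Ω : Type*} (X : ℕ → Ω → ℝ) (τ : Finset ℕ) (ω : Ω) : ℝ :=
  (∑ i ∈ τ, X i ω) / √(τ.card : ℝ)

/-- The distribution function `F_τ(x) = P{S_τ ≤ x}` of the normalized sum. -/
def sumCDF {Ω : Type*} [MeasurableSpace Ω] (P : Measure Ω) (X : ℕ → Ω → ℝ) (τ : Finset ℕ)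
    (x : ℝ) : ℝ :=
  P.real {ω | normSum X τ ω ≤ x}

/-- The family of all `k`-element subsets of the set of the first `n` indices. The sequence
`X₁, X₂, …` is indexed by `ℕ` from zero, so that these indices are `0, …, n - 1`. -/
def slice (n k : ℕ) : Finset (Finset ℕ) := Finset.powersetCard k (Finset.range n)

/-- The normalized counting measure on the family of `k`-element subsets, evaluated at the set
of all members of the family that lie in `A`. -/
def sliceMeasure (n k : ℕ) (A : Set (Finset ℕ)) : ℝ :=
  ((A ∩ (slice n k : Set (Finset ℕ))).ncard : ℝ) / ((slice n k).card : ℝ)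

/-- The range `1 ≪ k ≪ n` as a filter on the pairs `(n, k)` with `1 ≤ k ≤ n`: a limit along it
is a limit as `k → ∞` and `k / n → 0`. -/
def sparseRange : Filter (ℕ × ℕ) :=
  comap (fun p : ℕ × ℕ => p.2) atTop ⊓
    comap (fun p : ℕ × ℕ => (p.2 : ℝ) / (p.1 : ℝ)) (𝓝 0) ⊓
    𝓟 {p : ℕ × ℕ | 1 ≤ p.2 ∧ p.2 ≤ p.1}

end

/-! ### Entropy on slices and the modified logarithmic Sobolev inequality -/

section Slices

variable {α : Type*} [DecidableEq α]

/-! The law of `S_τ` is close, for most `τ`, to its average over the slice, and that average is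
close to the normal law.

Concentration. For smooth bounded `g` consider the function `u(τ) = E g(S_τ)` on the slice.
Exchanging `i ∈ τ` for `j ∉ τ` changes it, up to `O(1/k)`, by `(a_j - a_i)/√k` with `a_l = E g'(S_τ)
X_l`. Since the `X_l` are orthonormal, Bessel's inequality bounds `∑ a_l²` by `sup |g'|²`, whatever
the number of indices. Hence the sum of the squared changes over all exchanges is `O(n/k)`
(`sum_sq_integral_exchange_le`). The modified logarithmic Sobolev inequality on the slice
(`card_mul_sliceEntropy_le`) and Herbst's argument turn this into deviations of order `exp(-c k s²)`
(`card_filter_le_of_sq_sum_le`). Taking for `g` a smoothed step of width `h` gives, at each fixed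
point, deviations of the distribution functions with probability `O(exp(-c k h⁶))`
(`exists_card_deviation_le`). A union bound over `O(1/δ)` normal quantiles, with `h = δ/4`, controls
the whole line (`exists_sliceMeasure_levyDist_le`).

Average law. Sampling without replacement satisfies an approximate Stein identity: if `φ` is the
characteristic function of the average law, then `φ'(u) + u φ(u)` is small (`norm_sum_stein_le`,
`norm_integral_sum_stein_le`). Orthonormality, the law of large numbers for `X_j²` (upgraded to
`L¹`) and the bounded third moments control the error. Comparison with the equation of `exp(-u²/2)`,
Lévy's continuity theorem and a quantile grid give uniform convergence of the average distribution
function to `Φ`. The uniform distance between the two is the required `ε`.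

The bound so obtained, `(10/δ) exp(-c k δ⁶)`, is then weakened to the stated form. -/

theorem sum_powersetCard_sum_sdiff {M : Type*} [AddCommMonoid M] (T : Finset α) (r : ℕ)
    (G : Finset α → α → M) :
    ∑ s ∈ T.powersetCard r, ∑ j ∈ T \ s, G s j =
      ∑ t ∈ T.powersetCard (r + 1), ∑ j ∈ t, G (t.erase j) j := by
  rw [Finset.sum_sigma', Finset.sum_sigma']
  refine Finset.sum_bij' (fun p _ => ⟨insert p.2 p.1, p.2⟩) (fun p _ => ⟨p.1.erase p.2, p.2⟩)
    ?_ ?_ ?_ ?_ ?_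
  · rintro ⟨s, j⟩ h
    simp only [Finset.mem_sigma, Finset.mem_powersetCard, Finset.mem_sdiff] at h ⊢
    refine ⟨⟨Finset.insert_subset h.2.1 h.1.1, ?_⟩, Finset.mem_insert_self _ _⟩
    rw [Finset.card_insert_of_notMem h.2.2, h.1.2]
  · rintro ⟨t, j⟩ h
    simp only [Finset.mem_sigma, Finset.mem_powersetCard, Finset.mem_sdiff] at h ⊢
    refine ⟨⟨(Finset.erase_subset _ _).trans h.1.1, ?_⟩, h.1.1 h.2, Finset.notMem_erase _ _⟩
    rw [Finset.card_erase_of_mem h.2, h.1.2, Nat.add_sub_cancel]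
  · rintro ⟨s, j⟩ h
    simp only [Finset.mem_sigma, Finset.mem_sdiff] at h
    simp [Finset.erase_insert h.2.2]
  · rintro ⟨t, j⟩ h
    simp only [Finset.mem_sigma] at h
    simp [Finset.insert_erase h.2]
  · rintro ⟨s, j⟩ h
    simp only [Finset.mem_sigma, Finset.mem_sdiff] at h
    simp [Finset.erase_insert h.2.2]

theorem sum_sum_powersetCard_erase {M : Type*} [AddCommMonoid M] (S : Finset α) (r : ℕ)
    (G : Finset α → α → M) :
    ∑ l ∈ S, ∑ s ∈ (S.erase l).powersetCard r, G s l =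
      ∑ s ∈ S.powersetCard r, ∑ l ∈ S \ s, G s l := by
  refine Finset.sum_comm' ?_
  intro l s
  simp only [Finset.mem_powersetCard, Finset.mem_sdiff, Finset.subset_erase]
  tauto

theorem sum_powersetCard_insert {M : Type*} [AddCommMonoid M] {T : Finset α} {l : α}
    (hl : l ∉ T) (r : ℕ) (f : Finset α → M) :
    ∑ t ∈ (insert l T).powersetCard (r + 1), f t =
      ∑ t ∈ T.powersetCard (r + 1), f t + ∑ s ∈ T.powersetCard r, f (insert l s) := by
  rw [Finset.powersetCard_succ_insert hl, Finset.sum_union, Finset.sum_image]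
  · intro a ha b hb hab
    simp only [Finset.mem_coe, Finset.mem_powersetCard] at ha hb
    have ha' : l ∉ a := fun h => hl (ha.1 h)
    have hb' : l ∉ b := fun h => hl (hb.1 h)
    rw [← Finset.erase_insert ha', ← Finset.erase_insert hb', hab]
  · rw [Finset.disjoint_left]
    intro a ha hb
    obtain ⟨b, -, rfl⟩ := Finset.mem_image.1 hb
    exact hl ((Finset.mem_powersetCard.1 ha).1 (Finset.mem_insert_self _ _))

/-- The summand of the Dirichlet form of `f` and `log f`. -/
noncomputable def logForm (a b : ℝ) : ℝ := (a - b) * (Real.log a - Real.log b)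

theorem logForm_self (a : ℝ) : logForm a a = 0 := by simp [logForm]

theorem logForm_nonneg {a b : ℝ} (ha : 0 < a) (hb : 0 < b) : 0 ≤ logForm a b := by
  unfold logForm
  rcases le_total a b with h | h
  · exact mul_nonneg_of_nonpos_of_nonpos (by linarith) (by linarith [Real.log_le_log ha h])
  · exact mul_nonneg (by linarith) (by linarith [Real.log_le_log hb h])

/-- This is `log z ≤ z - 1` at `z = yX/(xY)`. When `X` and `Y` are the totals of the `x` and the
`y`, the terms without logarithms cancel on summation, which leaves the log-sum inequality. -/
theorem mul_log_sub_log_le {x y X Y : ℝ} (hx : 0 < x) (hy : 0 < y) (hX : 0 < X) (hY : 0 < Y) :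
    x * (Real.log X - Real.log Y) + x - y * X / Y ≤ x * (Real.log x - Real.log y) := by
  have h := Real.log_le_sub_one_of_pos (show 0 < (y * X) / (x * Y) by positivity)
  rw [Real.log_div (by positivity) (by positivity), Real.log_mul hy.ne' hX.ne',
    Real.log_mul hx.ne' hY.ne'] at h
  have h2 := mul_le_mul_of_nonneg_left h hx.le
  have h3 : x * (y * X / (x * Y) - 1) = y * X / Y - x := by field_simp
  nlinarith

/-- The log-sum inequality, in symmetric form. -/
theorem logForm_sum_le {ι : Type*} (s : Finset ι) (x y : ι → ℝ) (hx : ∀ i ∈ s, 0 < x i)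
    (hy : ∀ i ∈ s, 0 < y i) :
    logForm (∑ i ∈ s, x i) (∑ i ∈ s, y i) ≤ ∑ i ∈ s, logForm (x i) (y i) := by
  rcases s.eq_empty_or_nonempty with rfl | hs
  · simp [logForm]
  have key : ∀ x y : ι → ℝ, (∀ i ∈ s, 0 < x i) → (∀ i ∈ s, 0 < y i) →
      (∑ i ∈ s, x i) * (Real.log (∑ i ∈ s, x i) - Real.log (∑ i ∈ s, y i)) ≤
        ∑ i ∈ s, x i * (Real.log (x i) - Real.log (y i)) := by
    intro x y hx hy
    have hX := Finset.sum_pos hx hs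
    have hY := Finset.sum_pos hy hs
    have h := Finset.sum_le_sum fun i hi => mul_log_sub_log_le (hx i hi) (hy i hi) hX hY
    rw [Finset.sum_sub_distrib, Finset.sum_add_distrib, ← Finset.sum_mul, ← Finset.sum_div,
      ← Finset.sum_mul, mul_div_cancel_left₀ _ hY.ne'] at h
    linarith
  have h1 := key x y hx hy
  have h2 := key y x hy hx
  have h3 : ∑ i ∈ s, logForm (x i) (y i) = ∑ i ∈ s, x i * (Real.log (x i) - Real.log (y i)) +
      ∑ i ∈ s, y i * (Real.log (y i) - Real.log (x i)) := by
    rw [← Finset.sum_add_distrib]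
    exact Finset.sum_congr rfl fun i _ => by unfold logForm; ring
  rw [h3]
  unfold logForm
  linarith

/-- Concavity of the logarithm gives `u log a + v log b ≤ (u + v) log m` for the weighted mean `m`.
Multiplied by `m`, this is exactly the claim. -/
theorem two_point_entropy_le {u v a b : ℝ} (hu : 0 < u) (hv : 0 < v) (ha : 0 < a) (hb : 0 < b) :
    u * a * Real.log a + v * b * Real.log b -
        (u * a + v * b) * Real.log ((u * a + v * b) / (u + v)) ≤
      u * v / (u + v) * logForm a b := by
  set m := (u * a + v * b) / (u + v) with hm
  have hm0 : 0 < m := by positivity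
  have h1 := Real.log_le_sub_one_of_pos (show 0 < a / m by positivity)
  have h2 := Real.log_le_sub_one_of_pos (show 0 < b / m by positivity)
  rw [Real.log_div (by positivity) (by positivity)] at h1 h2
  have hmm : u * a + v * b = m * (u + v) := by rw [hm]; field_simp
  have h3 : u * (a / m - 1) + v * (b / m - 1) = 0 := by
    have : u * (a / m - 1) + v * (b / m - 1) = (u * a + v * b) / m - (u + v) := by
      field_simp
      ring
    rw [this, hmm]
    field_simp
    ring
  have h4 : u * Real.log a + v * Real.log b ≤ (u + v) * Real.log m := by
    have e1 := mul_le_mul_of_nonneg_left h1 hu.le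
    have e2 := mul_le_mul_of_nonneg_left h2 hv.le
    linarith
  have h5 := mul_le_mul_of_nonneg_left h4 hm0.le
  have h6 : m * (u * Real.log a + v * Real.log b) =
      u * a * Real.log a + v * b * Real.log b - u * v / (u + v) * logForm a b := by
    rw [hm]; unfold logForm
    field_simp
    ring
  rw [hmm]
  linarith

/-- The entropy of a positive function on the family of `k`-element subsets of `S`, multiplied by
the number of those subsets. -/
noncomputable def sliceEntropy (S : Finset α) (k : ℕ) (f : Finset α → ℝ) : ℝ :=
  ∑ t ∈ S.powersetCard k, f t * Real.log (f t) -
    (∑ t ∈ S.powersetCard k, f t) *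
      Real.log ((∑ t ∈ S.powersetCard k, f t) / (S.powersetCard k).card)

/-- The Dirichlet form of `f` and `log f` for exchanges of an element of an `(r + 1)`-element
subset of `S`; the subsets are parametrized by their common part. -/
noncomputable def sliceDirichlet (S : Finset α) (r : ℕ) (f : Finset α → ℝ) : ℝ :=
  ∑ s ∈ S.powersetCard r, ∑ i ∈ S \ s, ∑ j ∈ S \ s, logForm (f (insert i s)) (f (insert j s))

theorem sliceDirichlet_nonneg (S : Finset α) (r : ℕ) (f : Finset α → ℝ) (hf : ∀ t, 0 < f t) :
    0 ≤ sliceDirichlet S r f :=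
  Finset.sum_nonneg fun _ _ => Finset.sum_nonneg fun _ _ => Finset.sum_nonneg fun _ _ =>
    logForm_nonneg (hf _) (hf _)

theorem sliceEntropy_of_card_le {β : Type*} (S : Finset β) (k : ℕ) (f : Finset β → ℝ) (hk : S.card ≤ k) :
    sliceEntropy S k f = 0 := by
  unfold sliceEntropy
  rcases hk.lt_or_eq with h | h
  · simp [Finset.powersetCard_eq_empty.2 h]
  · simp [← h]

theorem sliceEntropy_zero {β : Type*} (S : Finset β) (f : Finset β → ℝ) : sliceEntropy S 0 f = 0 := by
  simp [sliceEntropy]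

/-- The chain rule for entropy, conditioning on whether the subset contains `l`. The remaining
entropy is that of a two-point variable, bounded by `two_point_entropy_le`; the log-sum inequality
spreads this bound over the exchanges that involve `l`. -/
theorem sliceEntropy_insert_le {T : Finset α} {l : α} (hl : l ∉ T) (r : ℕ) (hr : r + 1 ≤ T.card)
    (f : Finset α → ℝ) (hf : ∀ t, 0 < f t) :
    (T.card + 1 : ℝ) * sliceEntropy (insert l T) (r + 1) f ≤
      (T.card + 1 : ℝ) * (sliceEntropy T (r + 1) f + sliceEntropy T r fun s => f (insert l s)) +
        ∑ s ∈ T.powersetCard r, ∑ j ∈ T \ s, logForm (f (insert l s)) (f (insert j s)) := by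
  set A₀ := ∑ t ∈ T.powersetCard (r + 1), f t with hA₀
  set A₁ := ∑ s ∈ T.powersetCard r, f (insert l s) with hA₁
  set N₀ : ℝ := ((T.powersetCard (r + 1)).card : ℝ) with hN₀
  set N₁ : ℝ := ((T.powersetCard r).card : ℝ) with hN₁
  have ne₀ : (T.powersetCard (r + 1)).Nonempty := Finset.powersetCard_nonempty.2 hr
  have ne₁ : (T.powersetCard r).Nonempty := Finset.powersetCard_nonempty.2 (by omega)
  have pA₀ : 0 < A₀ := Finset.sum_pos (fun _ _ => hf _) ne₀
  have pA₁ : 0 < A₁ := Finset.sum_pos (fun _ _ => hf _) ne₁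
  have pN₀ : 0 < N₀ := by rw [hN₀]; exact_mod_cast ne₀.card_pos
  have pN₁ : 0 < N₁ := by rw [hN₁]; exact_mod_cast ne₁.card_pos
  have hcard : (((insert l T).powersetCard (r + 1)).card : ℝ) = N₀ + N₁ := by
    rw [hN₀, hN₁, Finset.card_eq_sum_ones, sum_powersetCard_insert hl]
    simp
  have hsd : ∀ s ∈ T.powersetCard r, ((T \ s).card : ℝ) = T.card - r := by
    intro s hs
    obtain ⟨h1, h2⟩ := Finset.mem_powersetCard.1 hs
    rw [Finset.card_sdiff_of_subset h1, h2, Nat.cast_sub (by omega)]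
  have hX : ∑ s ∈ T.powersetCard r, ∑ _j ∈ T \ s, f (insert l s) = (T.card - r) * A₁ := by
    rw [hA₁, Finset.mul_sum]
    refine Finset.sum_congr rfl fun s hs => ?_
    rw [Finset.sum_const, nsmul_eq_mul, hsd s hs]
  have hY : ∑ s ∈ T.powersetCard r, ∑ j ∈ T \ s, f (insert j s) = (r + 1) * A₀ := by
    rw [sum_powersetCard_sum_sdiff T r fun s j => f (insert j s), hA₀, Finset.mul_sum]
    refine Finset.sum_congr rfl fun t ht => ?_
    rw [Finset.sum_congr rfl fun j hj => by rw [Finset.insert_erase hj], Finset.sum_const,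
      nsmul_eq_mul, (Finset.mem_powersetCard.1 ht).2]
    push_cast; ring
  have hM : (r + 1) * N₀ = (T.card - r) * N₁ := by
    have h1 := sum_powersetCard_sum_sdiff T r fun _ _ => (1 : ℝ)
    simp only [Finset.sum_const, nsmul_eq_mul, mul_one] at h1
    rw [Finset.sum_congr rfl hsd, Finset.sum_congr (s₁ := T.powersetCard (r + 1)) rfl
      fun t ht => congrArg (Nat.cast (R := ℝ)) (Finset.mem_powersetCard.1 ht).2] at h1
    simp only [Finset.sum_const, nsmul_eq_mul] at h1
    push_cast at h1
    rw [← hN₀, ← hN₁] at h1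
    linarith
  have hrT : (0 : ℝ) < T.card - r := by
    have : (r + 1 : ℝ) ≤ T.card := by exact_mod_cast hr
    linarith
  have hls : logForm ((T.card - r) * A₁) ((r + 1) * A₀) ≤
      ∑ s ∈ T.powersetCard r, ∑ j ∈ T \ s, logForm (f (insert l s)) (f (insert j s)) := by
    rw [← hX, ← hY, Finset.sum_sigma', Finset.sum_sigma', Finset.sum_sigma']
    exact logForm_sum_le _ _ _ (fun _ _ => hf _) (fun _ _ => hf _)
  have h2 := two_point_entropy_le pN₀ pN₁ (div_pos pA₀ pN₀) (div_pos pA₁ pN₁)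
  have hsplit : sliceEntropy (insert l T) (r + 1) f =
      sliceEntropy T (r + 1) f + sliceEntropy T r (fun s => f (insert l s)) +
      (A₀ * Real.log (A₀ / N₀) + A₁ * Real.log (A₁ / N₁) -
        (A₀ + A₁) * Real.log ((A₀ + A₁) / (N₀ + N₁))) := by
    unfold sliceEntropy
    rw [hcard, sum_powersetCard_insert hl, sum_powersetCard_insert hl]
    ring
  have e₀ : N₀ * (A₀ / N₀) = A₀ := by field_simp
  have e₁ : N₁ * (A₁ / N₁) = A₁ := by field_simp
  rw [e₀, e₁] at h2
  -- `logForm` is homogeneous of degree one, and by `hM` both double sums are the same multiple `(r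
  -- + 1) * N₀` of the two block means.
  have hform : (T.card + 1 : ℝ) * (N₀ * N₁ / (N₀ + N₁) * logForm (A₀ / N₀) (A₁ / N₁)) =
      logForm ((T.card - r) * A₁) ((r + 1) * A₀) := by
    have hT : (T.card + 1 : ℝ) * (N₀ * N₁) = ((r + 1) * N₀) * (N₀ + N₁) := by
      linear_combination (-N₀) * hM
    have e1 : (T.card - r) * A₁ = ((r + 1) * N₀) * (A₁ / N₁) := by
      rw [hM]; field_simp
    have e2 : (r + 1) * A₀ = ((r + 1) * N₀) * (A₀ / N₀) := by field_simp
    have hr0 : (0 : ℝ) < (r + 1) * N₀ := by positivity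
    have hp : 0 < N₀ + N₁ := by positivity
    have e3 : (T.card + 1 : ℝ) * (N₀ * N₁ / (N₀ + N₁)) = (r + 1) * N₀ := by
      rw [mul_div_assoc', hT]; field_simp
    rw [e1, e2, ← mul_assoc, e3]
    unfold logForm
    rw [Real.log_mul hr0.ne' (div_pos pA₁ pN₁).ne', Real.log_mul hr0.ne' (div_pos pA₀ pN₀).ne']
    ring
  have hc : (0 : ℝ) ≤ T.card + 1 := by positivity
  have h3 := mul_le_mul_of_nonneg_left h2 hc
  rw [hsplit, mul_add]
  linarith

theorem sum_sum_sdiff_singleton {β : Type*} [DecidableEq β] (U : Finset β) (Q : β → β → ℝ)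
    (hQ : ∀ i, Q i i = 0) :
    ∑ l ∈ U, ∑ i ∈ U.erase l, ∑ j ∈ U.erase l, Q i j =
      (U.card - 2 : ℝ) * ∑ i ∈ U, ∑ j ∈ U, Q i j := by
  have h : ∀ l ∈ U, ∑ i ∈ U.erase l, ∑ j ∈ U.erase l, Q i j =
      ∑ i ∈ U, ∑ j ∈ U, Q i j - ∑ j ∈ U, Q l j - ∑ i ∈ U, Q i l := by
    intro l hl
    have h1 : ∀ i, ∑ j ∈ U.erase l, Q i j = ∑ j ∈ U, Q i j - Q i l := fun i => by
      rw [← Finset.add_sum_erase U _ hl]; ring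
    simp_rw [h1, Finset.sum_sub_distrib]
    rw [← Finset.add_sum_erase U (fun i => ∑ j ∈ U, Q i j) hl,
      ← Finset.add_sum_erase U (fun i => Q i l) hl, hQ]
    ring
  rw [Finset.sum_congr rfl h, Finset.sum_sub_distrib, Finset.sum_sub_distrib,
    Finset.sum_comm (f := fun l i => Q i l), Finset.sum_const, nsmul_eq_mul]
  ring

/-- The modified logarithmic Sobolev inequality on the family of `(r + 1)`-element subsets. -/
theorem card_mul_sliceEntropy_le (S : Finset α) (r : ℕ) (f : Finset α → ℝ) (hf : ∀ t, 0 < f t) :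
    (S.card : ℝ) * sliceEntropy S (r + 1) f ≤ sliceDirichlet S r f := by
  induction hn : S.card generalizing S r f with
  | zero =>
    simpa using sliceDirichlet_nonneg S r f hf
  | succ n ih =>
    rcases le_or_gt (n + 1) (r + 1) with hr | hr
    · rw [sliceEntropy_of_card_le S (r + 1) f (by omega), mul_zero]
      exact sliceDirichlet_nonneg S r f hf
    have hcard : ∀ l ∈ S, (S.erase l).card = n := fun l hl => by
      rw [Finset.card_erase_of_mem hl, hn, Nat.add_sub_cancel]
    have n0 : (0 : ℝ) < n := by exact_mod_cast (show 0 < n by omega)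
    have step : ∀ l ∈ S, (n + 1 : ℝ) * sliceEntropy S (r + 1) f ≤
        (n + 1 : ℝ) * (sliceEntropy (S.erase l) (r + 1) f +
          sliceEntropy (S.erase l) r fun s => f (insert l s)) +
        ∑ s ∈ (S.erase l).powersetCard r, ∑ j ∈ S \ s,
          logForm (f (insert l s)) (f (insert j s)) := by
      intro l hl
      have h := sliceEntropy_insert_le (Finset.notMem_erase l S) r
        (by rw [hcard l hl]; omega) f hf
      rw [Finset.insert_erase hl, hcard l hl] at h
      refine h.trans_eq ?_
      congr 1
      refine Finset.sum_congr rfl fun s hs => ?_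
      have hls : l ∈ S \ s := Finset.mem_sdiff.2 ⟨hl, fun h =>
        Finset.notMem_erase l S ((Finset.mem_powersetCard.1 hs).1 h)⟩
      rw [← Finset.add_sum_erase _ _ hls, logForm_self, zero_add, Finset.erase_sdiff_comm]
    have hsum := Finset.sum_le_sum step
    rw [Finset.sum_const, nsmul_eq_mul, hn, Finset.sum_add_distrib, ← Finset.mul_sum,
      Finset.sum_add_distrib,
      sum_sum_powersetCard_erase S r fun s l =>
        ∑ j ∈ S \ s, logForm (f (insert l s)) (f (insert j s))] at hsum
    change _ ≤ _ + sliceDirichlet S r f at hsum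
    -- An exchange of `i` and `j` over a common part `s` takes place among the subsets avoiding `l`
    -- for the `n + 1 - r - 2` choices of `l` outside `s`, `i`, `j`, and among those containing `l`
    -- for the `r` choices in `s` (`second`). Together this is `n - 1`.
    have first : (n : ℝ) * ∑ l ∈ S, sliceEntropy (S.erase l) (r + 1) f ≤
        (n - r - 1) * sliceDirichlet S r f := by
      rw [Finset.mul_sum]
      refine (Finset.sum_le_sum fun l hl => ih (S.erase l) r f hf (hcard l hl)).trans_eq ?_
      unfold sliceDirichlet
      rw [sum_sum_powersetCard_erase S r fun s l => ∑ i ∈ S.erase l \ s, ∑ j ∈ S.erase l \ s,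
        logForm (f (insert i s)) (f (insert j s)), Finset.mul_sum]
      refine Finset.sum_congr rfl fun s hs => ?_
      have h := sum_sum_sdiff_singleton (S \ s) (fun i j =>
        logForm (f (insert i s)) (f (insert j s))) fun i => logForm_self _
      obtain ⟨h1, h2⟩ := Finset.mem_powersetCard.1 hs
      simp_rw [Finset.erase_sdiff_comm]
      rw [h, Finset.card_sdiff_of_subset h1, h2, hn, Nat.cast_sub (by omega)]
      push_cast
      ring
    have second : (n : ℝ) * ∑ l ∈ S, sliceEntropy (S.erase l) r (fun s => f (insert l s)) ≤
        r * sliceDirichlet S r f := by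
      rcases r with _ | q
      · simp [sliceEntropy_zero]
      rw [Finset.mul_sum]
      refine (Finset.sum_le_sum fun l hl => ih (S.erase l) q (fun s => f (insert l s))
        (fun _ => hf _) (hcard l hl)).trans_eq ?_
      unfold sliceDirichlet
      rw [sum_sum_powersetCard_erase S q fun s l => ∑ i ∈ S.erase l \ s, ∑ j ∈ S.erase l \ s,
        logForm (f (insert l (insert i s))) (f (insert l (insert j s))),
        sum_powersetCard_sum_sdiff S q fun s l => ∑ i ∈ S.erase l \ s, ∑ j ∈ S.erase l \ s,
        logForm (f (insert l (insert i s))) (f (insert l (insert j s))), Finset.mul_sum]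
      refine Finset.sum_congr rfl fun t ht => ?_
      obtain ⟨h1, h2⟩ := Finset.mem_powersetCard.1 ht
      rw [← h2, ← nsmul_eq_mul, ← Finset.sum_const]
      refine Finset.sum_congr rfl fun l hl => ?_
      have hsd : S.erase l \ t.erase l = S \ t := by
        ext x
        simp only [Finset.mem_sdiff, Finset.mem_erase]
        constructor
        · rintro ⟨⟨a, b⟩, c⟩
          exact ⟨b, fun h => c ⟨a, h⟩⟩
        · rintro ⟨a, b⟩
          exact ⟨⟨fun h => b (h ▸ hl), a⟩, fun h => b h.2⟩
      rw [hsd]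
      have hins : ∀ i, insert l (insert i (t.erase l)) = insert i t := fun i => by
        rw [Finset.insert_comm, Finset.insert_erase hl]
      simp_rw [hins]
    have hD := sliceDirichlet_nonneg S r f hf
    push_cast at hsum ⊢
    set E₁ := ∑ l ∈ S, sliceEntropy (S.erase l) (r + 1) f
    set E₂ := ∑ l ∈ S, sliceEntropy (S.erase l) r (fun s => f (insert l s))
    set D := sliceDirichlet S r f
    set E := sliceEntropy S (r + 1) f
    have hE : (n : ℝ) * (E₁ + E₂) ≤ (n - 1) * D := by linarith
    have h1 : (n + 1 : ℝ) * n * ((n + 1) * E) ≤ (n + 1) * ((n - 1) * D) + n * D := by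
      have e1 := mul_le_mul_of_nonneg_left hsum n0.le
      have e2 := mul_le_mul_of_nonneg_left hE (show (0 : ℝ) ≤ n + 1 by positivity)
      nlinarith
    -- The induction closes because `(n + 1)(n - 1) + n = (n + 1)n - 1`.
    have h2 : (n + 1 : ℝ) * n * ((n + 1) * E) ≤ (n + 1) * n * D := by
      nlinarith
    exact le_of_mul_le_mul_left h2 (by positivity)

end Slices

/-! ### From the Sobolev inequality to Gaussian deviations -/

section Herbst

theorem logForm_exp_le (a b : ℝ) :
    logForm (Real.exp a) (Real.exp b) ≤ (a - b) ^ 2 * (Real.exp a + Real.exp b) := by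
  have key : ∀ x y : ℝ, y ≤ x → (Real.exp x - Real.exp y) * (x - y) ≤
      (x - y) ^ 2 * (Real.exp x + Real.exp y) := by
    intro x y h
    have h1 := Real.add_one_le_exp (y - x)
    have h2 : Real.exp y = Real.exp x * Real.exp (y - x) := by rw [← Real.exp_add]; ring_nf
    have h3 : Real.exp x - Real.exp y ≤ Real.exp x * (x - y) := by
      rw [h2]; nlinarith [Real.exp_pos x]
    have h4 := mul_le_mul_of_nonneg_right h3 (sub_nonneg.2 h)
    nlinarith [mul_nonneg (sq_nonneg (x - y)) (Real.exp_pos y).le]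
  unfold logForm
  rw [Real.log_exp, Real.log_exp]
  rcases le_total b a with h | h
  · exact key a b h
  · have := key b a h
    nlinarith

/-- Herbst's argument. -/
theorem le_of_mul_deriv_sub_le {K K' : ℝ → ℝ} {c : ℝ} (hK : ∀ l, HasDerivAt K (K' l) l)
    (hK0 : K 0 = 0) (h : ∀ l, 0 < l → l * K' l - K l ≤ c * l ^ 2) {l : ℝ} (hl : 0 < l) :
    K l ≤ K' 0 * l + c * l ^ 2 := by
  have hD : ∀ x : ℝ, 0 < x →
      HasDerivAt (fun y => K y / y - c * y) ((K' x * x - K x * 1) / x ^ 2 - c * 1) x := fun x hx =>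
    ((hK x).div (hasDerivAt_id x) hx.ne').sub ((hasDerivAt_id x).const_mul c)
  -- The hypothesis says that the derivative of `K y / y` is at most `c`; the limit of `K y / y` at
  -- zero is `K' 0`.
  have hanti : AntitoneOn (fun y => K y / y - c * y) (Set.Ioi 0) := by
    refine antitoneOn_of_deriv_nonpos (convex_Ioi 0)
      (fun x hx => (hD x hx).continuousAt.continuousWithinAt)
      (fun x hx => (hD x (interior_subset hx)).differentiableAt.differentiableWithinAt) ?_
    intro x hx
    rw [interior_Ioi] at hx
    have hx0 : 0 < x := hx
    rw [(hD x hx0).deriv, mul_one, mul_one, sub_nonpos, div_le_iff₀ (by positivity)]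
    linarith [h x hx0]
  have hlim : Tendsto (fun y => K y / y - c * y) (𝓝[>] 0) (𝓝 (K' 0 - c * 0)) := by
    refine Tendsto.sub ?_ ?_
    · have h1 := (hasDerivAt_iff_tendsto_slope.1 (hK 0)).mono_left
        (nhdsWithin_mono 0 (fun x (hx : 0 < x) => hx.ne'))
      refine h1.congr fun y => ?_
      rw [slope_def_field, hK0, sub_zero, sub_zero]
    · exact ((continuous_const.mul continuous_id).tendsto 0).mono_left nhdsWithin_le_nhds
  have hle : K l / l - c * l ≤ K' 0 - c * 0 := by
    refine ge_of_tendsto hlim ?_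
    filter_upwards [Ioo_mem_nhdsGT hl] with y hy
    exact hanti hy.1 hl hy.2.le
  have h2 : K l / l ≤ K' 0 + c * l := by linarith
  rw [div_le_iff₀ hl] at h2
  linarith

variable {α : Type*} [DecidableEq α]

/-- By symmetry in `i` and `j`, the sum of two exponentials in `logForm_exp_le` may be replaced by
twice one of them. Regrouping by the full subset `t` then leaves `exp (u t)` times the squared
gradient of `u` at `t`. -/
theorem sliceDirichlet_exp_le (S : Finset α) (r : ℕ) (u : Finset α → ℝ) (V : ℝ)
    (hV : ∀ t ∈ S.powersetCard (r + 1), ∑ i ∈ t, ∑ j ∈ S \ t.erase i,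
      (u t - u (insert j (t.erase i))) ^ 2 ≤ V) :
    sliceDirichlet S r (fun t => Real.exp (u t)) ≤
      2 * V * ∑ t ∈ S.powersetCard (r + 1), Real.exp (u t) := by
  have h1 : sliceDirichlet S r (fun t => Real.exp (u t)) ≤
      ∑ s ∈ S.powersetCard r, 2 * ∑ i ∈ S \ s, ∑ j ∈ S \ s,
        (u (insert i s) - u (insert j s)) ^ 2 * Real.exp (u (insert i s)) := by
    refine Finset.sum_le_sum fun s _ => ?_
    rw [two_mul]
    nth_rewrite 2 [Finset.sum_comm]
    rw [← Finset.sum_add_distrib]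
    refine Finset.sum_le_sum fun i _ => ?_
    rw [← Finset.sum_add_distrib]
    refine Finset.sum_le_sum fun j _ => (logForm_exp_le _ _).trans_eq ?_
    ring
  refine h1.trans ?_
  rw [← Finset.mul_sum, mul_assoc]
  refine mul_le_mul_of_nonneg_left ?_ zero_le_two
  rw [sum_powersetCard_sum_sdiff S r fun s i => ∑ j ∈ S \ s,
        (u (insert i s) - u (insert j s)) ^ 2 * Real.exp (u (insert i s)), Finset.mul_sum]
  refine Finset.sum_le_sum fun t ht => ?_
  refine le_of_eq_of_le ?_ (mul_le_mul_of_nonneg_right (hV t ht) (Real.exp_pos (u t)).le)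
  rw [Finset.sum_mul]
  refine Finset.sum_congr rfl fun i hi => ?_
  rw [Finset.insert_erase hi, Finset.sum_mul]

/-- A Gaussian upper deviation inequality on the family of `(r + 1)`-element subsets of `S`. -/
theorem card_filter_le_of_sq_sum_le (S : Finset α) (r : ℕ) (hr : r + 1 ≤ S.card)
    (u : Finset α → ℝ) {V : ℝ} (hV0 : 0 < V)
    (hV : ∀ t ∈ S.powersetCard (r + 1), ∑ i ∈ t, ∑ j ∈ S \ t.erase i,
      (u t - u (insert j (t.erase i))) ^ 2 ≤ V * S.card)
    {s : ℝ} (hs : 0 < s) :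
    (((S.powersetCard (r + 1)).filter fun t =>
      (∑ t ∈ S.powersetCard (r + 1), u t) / (S.powersetCard (r + 1)).card + s ≤ u t).card : ℝ) ≤
      (S.powersetCard (r + 1)).card * Real.exp (-(s ^ 2 / (8 * V))) := by
  set Q := S.powersetCard (r + 1) with hQ
  have hne : Q.Nonempty := Finset.powersetCard_nonempty.2 hr
  set N : ℝ := (Q.card : ℝ) with hN
  have hN0 : 0 < N := by rw [hN]; exact_mod_cast hne.card_pos
  have hn0 : (0 : ℝ) < S.card := by exact_mod_cast (show 0 < S.card by omega)
  set m := (∑ t ∈ Q, u t) / N with hm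
  set H : ℝ → ℝ := fun l => ∑ t ∈ Q, Real.exp (l * u t) with hH
  have hHpos : ∀ l, 0 < H l := fun l => Finset.sum_pos (fun _ _ => Real.exp_pos _) hne
  have hHd : ∀ l, HasDerivAt H (∑ t ∈ Q, Real.exp (l * u t) * u t) l := by
    intro l
    refine HasDerivAt.fun_sum fun t _ => ?_
    simpa using ((hasDerivAt_id l).mul_const (u t)).exp
  have hKd : ∀ l, HasDerivAt (fun l => Real.log (H l / N))
      ((∑ t ∈ Q, Real.exp (l * u t) * u t) / H l) l := by
    intro l
    have h := ((hHd l).div_const N).log (div_pos (hHpos l) hN0).ne'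
    convert h using 1
    have := (hHpos l).ne'
    field_simp
  have hent : ∀ l, 0 < l → l * ((∑ t ∈ Q, Real.exp (l * u t) * u t) / H l) - Real.log (H l / N) ≤
      (2 * V) * l ^ 2 := by
    intro l hl
    have h1 := card_mul_sliceEntropy_le S r (fun t => Real.exp (l * u t)) fun _ => Real.exp_pos _
    have h2 := sliceDirichlet_exp_le S r (fun t => l * u t) (l ^ 2 * (V * S.card)) fun t ht => by
      refine le_of_eq_of_le ?_ (mul_le_mul_of_nonneg_left (hV t ht) (sq_nonneg l))
      simp_rw [Finset.mul_sum]
      refine Finset.sum_congr rfl fun i _ => Finset.sum_congr rfl fun j _ => ?_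
      ring
    have h3 := h1.trans h2
    rw [← hQ] at h3
    have h4 : sliceEntropy S (r + 1) (fun t => Real.exp (l * u t)) =
        l * (∑ t ∈ Q, Real.exp (l * u t) * u t) - H l * Real.log (H l / N) := by
      unfold sliceEntropy
      rw [← hQ, Finset.mul_sum]
      congr 1
      refine Finset.sum_congr rfl fun t _ => ?_
      rw [Real.log_exp]; ring
    rw [h4] at h3
    change _ ≤ _ * H l at h3
    have h5 : l * (∑ t ∈ Q, Real.exp (l * u t) * u t) - H l * Real.log (H l / N) ≤
        2 * V * l ^ 2 * H l := by
      refine le_of_mul_le_mul_left (h3.trans_eq ?_) hn0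
      ring
    have := hHpos l
    rw [← mul_le_mul_iff_left₀ this]
    refine le_of_eq_of_le ?_ h5
    field_simp
  have hH0 : H 0 = N := by simp [hH, hN]
  have hK0 : Real.log (H 0 / N) = 0 := by rw [hH0, div_self hN0.ne', Real.log_one]
  -- The minimizer of `-l s + 2 V l²`, with minimum `-s²/(8V)`.
  set l := s / (4 * V) with hl
  have hl0 : 0 < l := by positivity
  have hlap := le_of_mul_deriv_sub_le hKd hK0 hent hl0
  have hm0 : (∑ t ∈ Q, Real.exp (0 * u t) * u t) / H 0 = m := by
    rw [hH0, hm]; simp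
  rw [hm0, Real.log_le_iff_le_exp (div_pos (hHpos l) hN0), div_le_iff₀ hN0] at hlap
  have hmark : ((Q.filter fun t => m + s ≤ u t).card : ℝ) * Real.exp (l * (m + s)) ≤ H l := by
    rw [← nsmul_eq_mul, ← Finset.sum_const]
    refine (Finset.sum_le_sum fun t ht => ?_).trans
      (Finset.sum_le_sum_of_subset_of_nonneg (Finset.filter_subset _ _)
        fun _ _ _ => (Real.exp_pos _).le)
    exact Real.exp_le_exp.2 (mul_le_mul_of_nonneg_left (Finset.mem_filter.1 ht).2 hl0.le)
  have h6 := hmark.trans hlap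
  rw [← le_div_iff₀ (Real.exp_pos _)] at h6
  refine h6.trans_eq ?_
  rw [mul_comm, mul_div_assoc, ← Real.exp_sub]
  congr 2
  rw [hl]
  field_simp
  ring

end Herbst

/-! ### A smooth cutoff with a quadratic Taylor bound -/

section SmoothStep

theorem exists_smooth_step : ∃ K : ℝ, 0 < K ∧ ∃ φ φ' : ℝ → ℝ, Continuous φ ∧ Continuous φ' ∧
    (∀ x, 0 ≤ φ x) ∧ (∀ x, φ x ≤ 1) ∧ (∀ x, x ≤ 0 → φ x = 0) ∧ (∀ x, 1 ≤ x → φ x = 1) ∧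
    (∀ x, |φ' x| ≤ K) ∧ ∀ x s, |φ (x + s) - φ x - φ' x * s| ≤ K * s ^ 2 := by
  have hφ : ContDiff ℝ 2 Real.smoothTransition := Real.smoothTransition.contDiff (n := 2)
  have hφ' : ContDiff ℝ 1 (deriv Real.smoothTransition) := by
    have h : ContDiff ℝ (1 + 1) Real.smoothTransition := hφ
    exact (contDiff_succ_iff_deriv.1 h).2.2
  have hsupp : HasCompactSupport (deriv Real.smoothTransition) := by
    refine HasCompactSupport.intro (isCompact_Icc (a := (0 : ℝ)) (b := 1)) fun x hx => ?_
    rw [Set.mem_Icc, not_and_or, not_le, not_le] at hx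
    rcases hx with hx | hx
    · have : Real.smoothTransition =ᶠ[𝓝 x] fun _ => 0 := by
        filter_upwards [Iio_mem_nhds hx] with y hy
        exact Real.smoothTransition.zero_of_nonpos (le_of_lt hy)
      rw [this.deriv_eq, deriv_const]
    · have : Real.smoothTransition =ᶠ[𝓝 x] fun _ => 1 := by
        filter_upwards [Ioi_mem_nhds hx] with y hy
        exact Real.smoothTransition.one_of_one_le (le_of_lt hy)
      rw [this.deriv_eq, deriv_const]
  obtain ⟨C₁, hC₁⟩ := hsupp.exists_bound_of_continuous hφ'.continuous
  obtain ⟨C₂, hC₂⟩ := hsupp.deriv.exists_bound_of_continuous (hφ'.continuous_deriv le_rfl)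
  have hC₂0 : 0 ≤ C₂ := (norm_nonneg _).trans (hC₂ 0)
  have hC₁0 : 0 ≤ C₁ := (norm_nonneg _).trans (hC₁ 0)
  refine ⟨C₁ + C₂ + 1, by positivity, Real.smoothTransition, deriv Real.smoothTransition,
    hφ.continuous, hφ'.continuous, Real.smoothTransition.nonneg, Real.smoothTransition.le_one,
    fun x => Real.smoothTransition.zero_of_nonpos, fun x => Real.smoothTransition.one_of_one_le,
    fun x => (hC₁ x).trans (by linarith), fun x s => ?_⟩
  have hlip : ∀ y, ‖deriv Real.smoothTransition y - deriv Real.smoothTransition x‖ ≤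
      C₂ * ‖y - x‖ := fun y =>
    convex_univ.norm_image_sub_le_of_norm_deriv_le
      (fun z _ => (hφ'.differentiable one_ne_zero) z) (fun z _ => hC₂ z)
      (Set.mem_univ x) (Set.mem_univ y)
  have hder : ∀ y ∈ Set.uIcc x (x + s), HasDerivWithinAt
      (fun z => Real.smoothTransition z - deriv Real.smoothTransition x * z)
      (deriv Real.smoothTransition y - deriv Real.smoothTransition x * 1)
      (Set.uIcc x (x + s)) y := fun y _ =>
    (((hφ.differentiable two_ne_zero) y).hasDerivAt.sub
      ((hasDerivAt_id y).const_mul _)).hasDerivWithinAt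
  have h := (convex_uIcc x (x + s)).norm_image_sub_le_of_norm_hasDerivWithin_le (C := C₂ * |s|)
    hder (fun y hy => by
      rw [mul_one]
      refine (hlip y).trans (mul_le_mul_of_nonneg_left ?_ hC₂0)
      have := Set.abs_sub_left_of_mem_uIcc hy
      simpa using this) Set.left_mem_uIcc Set.right_mem_uIcc
  rw [Real.norm_eq_abs, Real.norm_eq_abs, add_sub_cancel_left] at h
  have h2 : C₂ * |s| * |s| = C₂ * s ^ 2 := by rw [mul_assoc, abs_mul_abs_self, sq]
  rw [h2] at h
  refine le_trans (le_of_eq ?_) (h.trans ?_)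
  · congr 1; ring
  · nlinarith [sq_nonneg s]

end SmoothStep

/-! ### The exchange gradient of `E g(S_t)` and its concentration -/

section Gradient

variable {Ω : Type*} [MeasurableSpace Ω] {P : Measure Ω}

theorem memLp_sum_mul {X : ℕ → Ω → ℝ} (hX : ∀ j, MemLp (X j) 2 P) (S : Finset ℕ) (a : ℕ → ℝ) :
    MemLp (fun ω => ∑ l ∈ S, a l * X l ω) 2 P :=
  memLp_finsetSum S fun l _ => (hX l).const_mul (a l)

theorem integral_sum_mul_sq {X : ℕ → Ω → ℝ} (hX : ∀ j, MemLp (X j) 2 P)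
    (horth : ∀ i j, ∫ ω, X i ω * X j ω ∂P = if i = j then 1 else 0) (S : Finset ℕ) (a : ℕ → ℝ) :
    ∫ ω, (∑ l ∈ S, a l * X l ω) ^ 2 ∂P = ∑ l ∈ S, a l ^ 2 := by
  have hint : ∀ i j, Integrable (fun ω => (a i * X i ω) * (a j * X j ω)) P := fun i j =>
    ((hX i).const_mul (a i)).integrable_mul ((hX j).const_mul (a j))
  have h1 : ∀ ω, (∑ l ∈ S, a l * X l ω) ^ 2 =
      ∑ i ∈ S, ∑ j ∈ S, (a i * X i ω) * (a j * X j ω) := fun ω => by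
    rw [sq, Finset.sum_mul_sum]
  simp_rw [h1]
  rw [integral_finsetSum _ fun i _ => integrable_finsetSum _ fun j _ => hint i j]
  refine Finset.sum_congr rfl fun i hi => ?_
  rw [integral_finsetSum _ fun j _ => hint i j]
  have h2 : ∀ j, ∫ ω, (a i * X i ω) * (a j * X j ω) ∂P = if i = j then a i * a j else 0 := by
    intro j
    have : ∀ ω, (a i * X i ω) * (a j * X j ω) = a i * a j * (X i ω * X j ω) := fun ω => by ring
    simp_rw [this]
    rw [integral_const_mul, horth]
    split_ifs <;> simp
  simp_rw [h2]
  rw [Finset.sum_ite_eq, if_pos hi, sq]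

/-- Bessel's inequality for a bounded function. -/
theorem sum_sq_integral_mul_le [IsProbabilityMeasure P] {X : ℕ → Ω → ℝ}
    (hX : ∀ j, MemLp (X j) 2 P)
    (horth : ∀ i j, ∫ ω, X i ω * X j ω ∂P = if i = j then 1 else 0) (S : Finset ℕ)
    {f : Ω → ℝ} (hf : AEStronglyMeasurable f P) {G : ℝ} (hG : ∀ ω, |f ω| ≤ G) :
    ∑ l ∈ S, (∫ ω, f ω * X l ω ∂P) ^ 2 ≤ G ^ 2 := by
  have hf2 : MemLp f 2 P := MemLp.of_bound hf G (ae_of_all _ hG)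
  set a : ℕ → ℝ := fun l => ∫ ω, f ω * X l ω ∂P with ha
  have hY := memLp_sum_mul hX S a
  have h0 : 0 ≤ ∫ ω, (f ω - ∑ l ∈ S, a l * X l ω) ^ 2 ∂P := integral_nonneg fun _ => sq_nonneg _
  have hcross : ∫ ω, f ω * (∑ l ∈ S, a l * X l ω) ∂P = ∑ l ∈ S, a l ^ 2 := by
    have h1 : ∀ ω, f ω * (∑ l ∈ S, a l * X l ω) = ∑ l ∈ S, a l * (f ω * X l ω) := fun ω => by
      rw [Finset.mul_sum]
      exact Finset.sum_congr rfl fun l _ => by ring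
    have h2 : ∀ l, Integrable (fun ω => a l * (f ω * X l ω)) P := fun l =>
      (hf2.integrable_mul (hX l)).const_mul (a l)
    simp_rw [h1]
    rw [integral_finsetSum _ fun l _ => h2 l]
    refine Finset.sum_congr rfl fun l _ => ?_
    rw [integral_const_mul, sq]
  have hexp : ∫ ω, (f ω - ∑ l ∈ S, a l * X l ω) ^ 2 ∂P =
      ∫ ω, f ω ^ 2 ∂P - 2 * ∑ l ∈ S, a l ^ 2 + ∑ l ∈ S, a l ^ 2 := by
    have h1 : ∀ ω, (f ω - ∑ l ∈ S, a l * X l ω) ^ 2 =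
        f ω ^ 2 - 2 * (f ω * ∑ l ∈ S, a l * X l ω) + (∑ l ∈ S, a l * X l ω) ^ 2 := fun ω => by ring
    have i1 : Integrable (fun ω => f ω ^ 2) P := hf2.integrable_sq
    have i2 : Integrable (fun ω => 2 * (f ω * ∑ l ∈ S, a l * X l ω)) P :=
      (hf2.integrable_mul hY).const_mul 2
    have i3 : Integrable (fun ω => (∑ l ∈ S, a l * X l ω) ^ 2) P := hY.integrable_sq
    have i4 : Integrable (fun ω => f ω ^ 2 - 2 * (f ω * ∑ l ∈ S, a l * X l ω)) P := i1.sub i2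
    simp_rw [h1]
    rw [integral_add i4 i3, integral_sub i1 i2, integral_const_mul, hcross,
      integral_sum_mul_sq hX horth]
  have hG2 : ∫ ω, f ω ^ 2 ∂P ≤ G ^ 2 := by
    have := integral_mono (μ := P) hf2.integrable_sq (integrable_const (G ^ 2)) fun ω => by
      change f ω ^ 2 ≤ G ^ 2
      rw [← sq_abs]
      exact pow_le_pow_left₀ (abs_nonneg _) (hG ω) 2
    simpa using this
  rw [hexp] at h0
  linarith

theorem aemeasurable_normSum {X : ℕ → Ω → ℝ} (hX : ∀ j, AEMeasurable (X j) P) (t : Finset ℕ) :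
    AEMeasurable (normSum X t) P :=
  (Finset.aemeasurable_fun_sum t fun i _ => hX i).div_const _

theorem memLp_normSum {X : ℕ → Ω → ℝ} (hX : ∀ j, MemLp (X j) 2 P) (t : Finset ℕ) :
    MemLp (normSum X t) 2 P := by
  refine (memLp_sum_mul hX t fun _ => 1 / √(t.card : ℝ)).ae_eq (ae_of_all _ fun ω => ?_)
  unfold normSum
  rw [Finset.sum_div]
  exact Finset.sum_congr rfl fun i _ => by ring

theorem normSum_exchange {Ω' : Type*} (X : ℕ → Ω' → ℝ) {t : Finset ℕ} {i j : ℕ} (hi : i ∈ t)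
    (hj : j ∉ t.erase i) (ω : Ω') :
    normSum X (insert j (t.erase i)) ω = normSum X t ω + (X j ω - X i ω) / √(t.card : ℝ) := by
  have hc : (insert j (t.erase i)).card = t.card := by
    rw [Finset.card_insert_of_notMem hj, Finset.card_erase_add_one hi]
  unfold normSum
  rw [hc, Finset.sum_insert hj, ← Finset.add_sum_erase t _ hi]
  ring

/-- An exchange shifts the normalized sum by `(X j - X i) / √k`. The Taylor remainder of `g`
integrates to at most `K E (X j - X i)² / k`, and orthonormality bounds this second moment by 2. -/
theorem abs_integral_exchange_le [IsProbabilityMeasure P] {X : ℕ → Ω → ℝ}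
    (hX : ∀ j, MemLp (X j) 2 P)
    (horth : ∀ i j, ∫ ω, X i ω * X j ω ∂P = if i = j then 1 else 0)
    {g g' : ℝ → ℝ} (hg : Continuous g) (hg' : Continuous g') {B G K : ℝ}
    (hB : ∀ x, |g x| ≤ B) (hG : ∀ x, |g' x| ≤ G) (hK0 : 0 ≤ K)
    (hK : ∀ x s, |g (x + s) - g x - g' x * s| ≤ K * s ^ 2)
    {t : Finset ℕ} {i j : ℕ} (hi : i ∈ t) (hj : j ∉ t.erase i) :
    |∫ ω, g (normSum X (insert j (t.erase i)) ω) ∂P - ∫ ω, g (normSum X t ω) ∂P -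
      (∫ ω, g' (normSum X t ω) * X j ω ∂P - ∫ ω, g' (normSum X t ω) * X i ω ∂P) / √(t.card : ℝ)| ≤
      2 * K / t.card := by
  have hm : ∀ j, AEMeasurable (X j) P := fun j => (hX j).1.aemeasurable
  have hgm : ∀ s, Integrable (fun ω => g (normSum X s ω)) P := fun s =>
    Integrable.of_bound (hg.measurable.comp_aemeasurable
      (aemeasurable_normSum hm s)).aestronglyMeasurable B (ae_of_all _ fun ω => hB _)
  have hg2 : MemLp (fun ω => g' (normSum X t ω)) 2 P :=
    MemLp.of_bound (hg'.measurable.comp_aemeasurable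
      (aemeasurable_normSum hm t)).aestronglyMeasurable G (ae_of_all _ fun ω => hG _)
  have hprod : ∀ l, Integrable (fun ω => g' (normSum X t ω) * X l ω) P := fun l =>
    hg2.integrable_mul (hX l)
  have hlin : Integrable (fun ω => (g' (normSum X t ω) * X j ω - g' (normSum X t ω) * X i ω) /
      √(t.card : ℝ)) P := ((hprod j).sub (hprod i)).div_const _
  have hk : (0 : ℝ) < t.card := by exact_mod_cast Finset.card_pos.2 ⟨i, hi⟩
  have hdiff : Integrable (fun ω => g (normSum X (insert j (t.erase i)) ω) -
      g (normSum X t ω)) P := (hgm _).sub (hgm _)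
  rw [← integral_sub (hprod j) (hprod i), ← integral_div, ← integral_sub (hgm _) (hgm _),
    ← integral_sub hdiff hlin]
  have hsq : Integrable (fun ω => K * ((X j ω - X i ω) ^ 2 / t.card)) P :=
    ((((hX j).sub (hX i)).integrable_sq).div_const _).const_mul K
  have hbound : ∫ ω, K * ((X j ω - X i ω) ^ 2 / t.card) ∂P ≤ 2 * K / t.card := by
    have h1 : ∫ ω, (X j ω - X i ω) ^ 2 ∂P ≤ 2 := by
      have e : ∀ ω, (X j ω - X i ω) ^ 2 = X j ω * X j ω - 2 * (X j ω * X i ω) + X i ω * X i ω :=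
        fun ω => by ring
      simp_rw [e]
      have ii : ∀ a b, Integrable (fun ω => X a ω * X b ω) P := fun a b =>
        (hX a).integrable_mul (hX b)
      have i3 : Integrable (fun ω => X j ω * X j ω - 2 * (X j ω * X i ω)) P :=
        (ii j j).sub ((ii j i).const_mul 2)
      rw [integral_add i3 (ii i i),
        integral_sub (ii j j) ((ii j i).const_mul 2), integral_const_mul, horth, horth, horth]
      split_ifs <;> norm_num
    rw [integral_const_mul, integral_div, mul_div_assoc', mul_comm 2 K]
    gcongr
  refine (abs_integral_le_integral_abs).trans ((integral_mono_of_nonneg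
    (ae_of_all _ fun ω => abs_nonneg _) hsq (ae_of_all _ fun ω => ?_)).trans hbound)
  have h := hK (normSum X t ω) ((X j ω - X i ω) / √(t.card : ℝ))
  rw [← normSum_exchange X hi hj ω, div_pow, Real.sq_sqrt hk.le] at h
  refine le_of_eq_of_le ?_ h
  change |_| = |_|
  congr 1
  ring

/-- The total squared change of `t ↦ E g(S_t)` under exchanges of one element of `t`. -/
theorem sum_sq_integral_exchange_le [IsProbabilityMeasure P] {X : ℕ → Ω → ℝ}
    (hX : ∀ j, MemLp (X j) 2 P)
    (horth : ∀ i j, ∫ ω, X i ω * X j ω ∂P = if i = j then 1 else 0)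
    {g g' : ℝ → ℝ} (hg : Continuous g) (hg' : Continuous g') {B G K : ℝ}
    (hB : ∀ x, |g x| ≤ B) (hG : ∀ x, |g' x| ≤ G) (hK0 : 0 ≤ K)
    (hK : ∀ x s, |g (x + s) - g x - g' x * s| ≤ K * s ^ 2)
    (S t : Finset ℕ) (ht : t ⊆ S) (htc : 0 < t.card) :
    ∑ i ∈ t, ∑ j ∈ S \ t.erase i, (∫ ω, g (normSum X t ω) ∂P -
      ∫ ω, g (normSum X (insert j (t.erase i)) ω) ∂P) ^ 2 ≤
      (8 * G ^ 2 + 8 * K ^ 2) / t.card * S.card := by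
  have hk : (0 : ℝ) < t.card := by exact_mod_cast htc
  have hm : ∀ j, AEMeasurable (X j) P := fun j => (hX j).1.aemeasurable
  set k : ℝ := (t.card : ℝ) with hkdef
  set a : ℕ → ℝ := fun l => ∫ ω, g' (normSum X t ω) * X l ω ∂P with ha
  -- The decisive gain. Bounding each `a l ^ 2` separately would give a total of order `n` over the
  -- exchanges; Bessel's inequality, used in both `i` and `j`, gives order `n / k`.
  have hbes : ∀ U : Finset ℕ, ∑ l ∈ U, a l ^ 2 ≤ G ^ 2 := fun U =>
    sum_sq_integral_mul_le hX horth U (hg'.measurable.comp_aemeasurable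
      (aemeasurable_normSum hm t)).aestronglyMeasurable fun ω => hG _
  have hterm : ∀ i ∈ t, ∀ j ∈ S \ t.erase i, (∫ ω, g (normSum X t ω) ∂P -
      ∫ ω, g (normSum X (insert j (t.erase i)) ω) ∂P) ^ 2 ≤
      4 / k * a j ^ 2 + 4 / k * a i ^ 2 + 8 * K ^ 2 / k ^ 2 := by
    intro i hi j hj
    have h := abs_integral_exchange_le hX horth hg hg' hB hG hK0 hK hi (Finset.mem_sdiff.1 hj).2
    rw [← hkdef] at h
    set D := ∫ ω, g (normSum X (insert j (t.erase i)) ω) ∂P - ∫ ω, g (normSum X t ω) ∂P with hD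
    have e1 : (∫ ω, g (normSum X t ω) ∂P - ∫ ω, g (normSum X (insert j (t.erase i)) ω) ∂P) = -D := by
      rw [hD]; ring
    change |D - (a j - a i) / √k| ≤ _ at h
    have h1 : (D - (a j - a i) / √k) ^ 2 ≤ (2 * K / k) ^ 2 := by
      rw [← sq_abs]; exact pow_le_pow_left₀ (abs_nonneg _) h 2
    have h2 : ((a j - a i) / √k) ^ 2 = (a j - a i) ^ 2 / k := by
      rw [div_pow, Real.sq_sqrt hk.le]
    have h3 : (a j - a i) ^ 2 / k ≤ 2 / k * a j ^ 2 + 2 / k * a i ^ 2 := by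
      rw [div_mul_eq_mul_div, div_mul_eq_mul_div, ← add_div]
      gcongr
      nlinarith [sq_nonneg (a j + a i)]
    have h4 : D ^ 2 ≤ 2 * (D - (a j - a i) / √k) ^ 2 + 2 * ((a j - a i) / √k) ^ 2 := by
      nlinarith [sq_nonneg (D - 2 * ((a j - a i) / √k))]
    have h5 : (2 * K / k) ^ 2 = 4 * K ^ 2 / k ^ 2 := by ring
    have h6 : 8 * K ^ 2 / k ^ 2 = 2 * (4 * K ^ 2 / k ^ 2) := by ring
    have h7 : 4 / k * a j ^ 2 + 4 / k * a i ^ 2 = 2 * (2 / k * a j ^ 2 + 2 / k * a i ^ 2) := by ring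
    rw [e1, neg_sq, h6, h7]
    rw [h2] at h4
    rw [h5] at h1
    linarith
  have hnS : k ≤ S.card := by rw [hkdef]; exact_mod_cast Finset.card_le_card ht
  have hinner : ∀ i ∈ t, ∑ j ∈ S \ t.erase i, (∫ ω, g (normSum X t ω) ∂P -
      ∫ ω, g (normSum X (insert j (t.erase i)) ω) ∂P) ^ 2 ≤
      4 / k * G ^ 2 + S.card * (4 / k * a i ^ 2) + S.card * (8 * K ^ 2 / k ^ 2) := by
    intro i hi
    refine (Finset.sum_le_sum (hterm i hi)).trans ?_
    rw [Finset.sum_add_distrib, Finset.sum_add_distrib, ← Finset.mul_sum, Finset.sum_const,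
      Finset.sum_const, nsmul_eq_mul, nsmul_eq_mul]
    have hc : ((S \ t.erase i).card : ℝ) ≤ S.card := by
      exact_mod_cast Finset.card_le_card Finset.sdiff_subset
    gcongr
    exact hbes _
  refine (Finset.sum_le_sum hinner).trans ?_
  rw [Finset.sum_add_distrib, Finset.sum_add_distrib, Finset.sum_const, Finset.sum_const,
    nsmul_eq_mul, nsmul_eq_mul, ← hkdef, ← Finset.mul_sum, ← Finset.mul_sum]
  have h1 : k * (4 / k * G ^ 2) ≤ S.card * (4 / k * G ^ 2) := by gcongr
  have h2 : (S.card : ℝ) * (4 / k * ∑ i ∈ t, a i ^ 2) ≤ S.card * (4 / k * G ^ 2) := by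
    gcongr; exact hbes t
  have h3 : k * (S.card * (8 * K ^ 2 / k ^ 2)) = S.card * (8 * K ^ 2 / k) := by
    field_simp
  rw [h3]
  refine (add_le_add (add_le_add h1 h2) le_rfl).trans_eq ?_
  ring

/-- Gaussian upper deviations of `t ↦ E g(S_t)`. -/
theorem card_filter_integral_normSum_le [IsProbabilityMeasure P] {X : ℕ → Ω → ℝ}
    (hX : ∀ j, MemLp (X j) 2 P)
    (horth : ∀ i j, ∫ ω, X i ω * X j ω ∂P = if i = j then 1 else 0)
    {g g' : ℝ → ℝ} (hg : Continuous g) (hg' : Continuous g') {B G K : ℝ}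
    (hB : ∀ x, |g x| ≤ B) (hG : ∀ x, |g' x| ≤ G) (hK0 : 0 < K)
    (hK : ∀ x s, |g (x + s) - g x - g' x * s| ≤ K * s ^ 2) {n k : ℕ} (hk : 1 ≤ k) (hkn : k ≤ n)
    {s : ℝ} (hs : 0 < s) :
    (((slice n k).filter fun t => (∑ t ∈ slice n k, ∫ ω, g (normSum X t ω) ∂P) / (slice n k).card +
      s ≤ ∫ ω, g (normSum X t ω) ∂P).card : ℝ) ≤
      (slice n k).card * Real.exp (-(k * s ^ 2 / (64 * (G ^ 2 + K ^ 2)))) := by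
  obtain ⟨r, rfl⟩ : ∃ r, k = r + 1 := ⟨k - 1, by omega⟩
  have hr0 : (0 : ℝ) < ((r + 1 : ℕ) : ℝ) := by positivity
  have h := card_filter_le_of_sq_sum_le (Finset.range n) r (by simpa using hkn)
    (fun t => ∫ ω, g (normSum X t ω) ∂P) (V := (8 * G ^ 2 + 8 * K ^ 2) / ((r + 1 : ℕ) : ℝ))
    (by positivity) (fun t ht => ?_) hs
  · refine h.trans_eq ?_
    unfold slice
    congr 3
    field_simp
    ring
  · obtain ⟨h1, h2⟩ := Finset.mem_powersetCard.1 ht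
    have := sum_sq_integral_exchange_le hX horth hg hg' hB hG hK0.le hK (Finset.range n) t h1
      (by omega)
    rwa [h2] at this

end Gradient

/-! ### Stein's identity for sampling without replacement -/

section SteinDeterministic

theorem norm_cexp_mul_I_sub_one_le (x : ℝ) : ‖Complex.exp (x * Complex.I) - 1‖ ≤ |x| := by
  rw [mul_comm]
  exact Real.norm_exp_I_mul_ofReal_sub_one_le

theorem norm_cexp_mul_I_sub_one_sub_le (x : ℝ) :
    ‖Complex.exp (x * Complex.I) - 1 - x * Complex.I‖ ≤ 3 * x ^ 2 := by
  have hx : ‖(x : ℂ) * Complex.I‖ = |x| := by simp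
  rcases le_or_gt |x| 1 with h | h
  · refine (Complex.norm_exp_sub_one_sub_id_le (hx.trans_le h)).trans ?_
    rw [hx, sq_abs]
    nlinarith [sq_nonneg x]
  · refine (norm_sub_le _ _).trans ?_
    rw [hx]
    have h1 := norm_cexp_mul_I_sub_one_le x
    have h2 : |x| ≤ x ^ 2 := by rw [← sq_abs]; nlinarith
    linarith

/-- Taylor expansion of the exponential: to second order where it multiplies `y`, to first order
where it multiplies `u / K`. What remains is centred by `y² - 1/K`, the form to which the law of
large numbers applies. -/
theorem norm_mul_cexp_sub_le (y u K : ℝ) (hK : 0 < K) :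
    ‖((y : ℂ) - u / K * Complex.I) * Complex.exp ((u * y : ℝ) * Complex.I) -
      (y + u * (y ^ 2 - 1 / K) * Complex.I)‖ ≤ 3 * u ^ 2 * |y| ^ 3 + u ^ 2 * |y| / K := by
  have h1 := norm_cexp_mul_I_sub_one_sub_le (u * y)
  have h2 := norm_cexp_mul_I_sub_one_le (u * y)
  set E := Complex.exp ((u * y : ℝ) * Complex.I) with hE
  have e : ((y : ℂ) - u / K * Complex.I) * E - (y + u * (y ^ 2 - 1 / K) * Complex.I) =
      y * (E - 1 - (u * y : ℝ) * Complex.I) - (u / K : ℝ) * Complex.I * (E - 1) := by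
    push_cast; ring
  rw [e]
  refine (norm_sub_le _ _).trans ?_
  rw [norm_mul, norm_mul, norm_mul, Complex.norm_real, Complex.norm_real, Complex.norm_I, mul_one,
    Real.norm_eq_abs, Real.norm_eq_abs]
  have e1 : 3 * u ^ 2 * |y| ^ 3 = |y| * (3 * (u * y) ^ 2) := by
    rw [mul_pow, ← sq_abs y]; ring
  have e2 : u ^ 2 * |y| / K = |u / K| * |u * y| := by
    rw [abs_div, abs_mul, abs_of_pos hK, ← sq_abs u]; ring
  rw [e1, e2]
  gcongr

/-- Stein's identity for sampling without replacement, with an explicit error. -/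
theorem norm_sum_stein_le {α : Type*} [DecidableEq α] (S : Finset α) (r : ℕ) (y : α → ℝ) (u : ℝ) :
    ‖∑ t ∈ S.powersetCard (r + 1), (((∑ i ∈ t, y i : ℝ) : ℂ) - u * Complex.I) *
      Complex.exp ((u * ∑ i ∈ t, y i : ℝ) * Complex.I)‖ ≤
      ∑ s ∈ S.powersetCard r, (|∑ j ∈ S \ s, y j| +
        |u| * |∑ j ∈ S \ s, (y j ^ 2 - 1 / (r + 1))| +
        ∑ j ∈ S, (3 * u ^ 2 * |y j| ^ 3 + u ^ 2 * |y j| / (r + 1))) := by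
  have hK : (0 : ℝ) < r + 1 := by positivity
  -- The term `u * I` is shared equally among the `r + 1` elements of `t`, and the distinguished
  -- element `j` is split off. For fixed `s = t \ {j}` the exponential over `s` has modulus one, so
  -- only sums over `j ∉ s` matter.
  have h1 : ∑ t ∈ S.powersetCard (r + 1), (((∑ i ∈ t, y i : ℝ) : ℂ) - u * Complex.I) *
      Complex.exp ((u * ∑ i ∈ t, y i : ℝ) * Complex.I) =
      ∑ s ∈ S.powersetCard r, ∑ j ∈ S \ s, ((y j : ℂ) - u / (r + 1 : ℝ) * Complex.I) *
        Complex.exp ((u * ∑ i ∈ insert j s, y i : ℝ) * Complex.I) := by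
    rw [sum_powersetCard_sum_sdiff S r fun s j => ((y j : ℂ) - u / (r + 1 : ℝ) * Complex.I) *
        Complex.exp ((u * ∑ i ∈ insert j s, y i : ℝ) * Complex.I)]
    refine Finset.sum_congr rfl fun t ht => ?_
    have h : ∑ j ∈ t, ((y j : ℂ) - u / (r + 1 : ℝ) * Complex.I) *
        Complex.exp ((u * ∑ i ∈ insert j (t.erase j), y i : ℝ) * Complex.I) =
        (∑ j ∈ t, ((y j : ℂ) - u / (r + 1 : ℝ) * Complex.I)) *
          Complex.exp ((u * ∑ i ∈ t, y i : ℝ) * Complex.I) := by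
      rw [Finset.sum_mul]
      exact Finset.sum_congr rfl fun j hj => by rw [Finset.insert_erase hj]
    rw [h, Finset.sum_sub_distrib, Finset.sum_const, (Finset.mem_powersetCard.1 ht).2,
      nsmul_eq_mul]
    have : ((r + 1 : ℕ) : ℂ) * (u / (r + 1 : ℝ) * Complex.I) = u * Complex.I := by
      have : ((r : ℂ) + 1) ≠ 0 := by exact_mod_cast hK.ne'
      push_cast
      field_simp
    rw [this]
    push_cast
    rfl
  rw [h1]
  refine norm_sum_le_of_le _ fun s _ => ?_
  have h2 : ∑ j ∈ S \ s, ((y j : ℂ) - u / (r + 1 : ℝ) * Complex.I) *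
        Complex.exp ((u * ∑ i ∈ insert j s, y i : ℝ) * Complex.I) =
      Complex.exp ((u * ∑ i ∈ s, y i : ℝ) * Complex.I) * ∑ j ∈ S \ s,
        ((y j : ℂ) - u / (r + 1 : ℝ) * Complex.I) *
          Complex.exp ((u * y j : ℝ) * Complex.I) := by
    rw [Finset.mul_sum]
    refine Finset.sum_congr rfl fun j hj => ?_
    rw [Finset.sum_insert (Finset.mem_sdiff.1 hj).2, mul_add, Complex.ofReal_add (u * y j),
      add_mul ((u * y j : ℝ) : ℂ), Complex.exp_add]
    ring
  rw [h2, norm_mul, Complex.norm_exp_ofReal_mul_I, one_mul]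
  have h3 : ∑ j ∈ S \ s, ((y j : ℂ) - u / (r + 1 : ℝ) * Complex.I) *
          Complex.exp ((u * y j : ℝ) * Complex.I) =
      ((∑ j ∈ S \ s, y j : ℝ) : ℂ) +
        u * ((∑ j ∈ S \ s, (y j ^ 2 - 1 / (r + 1)) : ℝ) : ℂ) * Complex.I +
      ∑ j ∈ S \ s, (((y j : ℂ) - u / (r + 1 : ℝ) * Complex.I) *
          Complex.exp ((u * y j : ℝ) * Complex.I) -
        (y j + u * (y j ^ 2 - 1 / (r + 1 : ℝ)) * Complex.I)) := by
    rw [Finset.sum_sub_distrib (s := S \ s) (f := fun j =>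
        ((y j : ℂ) - u / (r + 1 : ℝ) * Complex.I) * Complex.exp ((u * y j : ℝ) * Complex.I)),
      Finset.sum_add_distrib, ← Finset.sum_mul, ← Finset.mul_sum]
    push_cast
    ring
  rw [h3]
  refine (norm_add_le _ _).trans (add_le_add ((norm_add_le _ _).trans (add_le_add ?_ ?_)) ?_)
  · rw [Complex.norm_real, Real.norm_eq_abs]
  · rw [norm_mul, norm_mul, Complex.norm_real, Complex.norm_real, Complex.norm_I, mul_one,
      Real.norm_eq_abs, Real.norm_eq_abs]
  · refine (norm_sum_le_of_le _ fun j _ => norm_mul_cexp_sub_le (y j) u (r + 1) hK).trans ?_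
    exact Finset.sum_le_sum_of_subset_of_nonneg Finset.sdiff_subset fun j _ _ => by positivity

end SteinDeterministic

/-! ### The Stein error in expectation -/

section SteinIntegral

variable {Ω : Type*} [MeasurableSpace Ω] {P : Measure Ω} [IsProbabilityMeasure P]

theorem integral_abs_le_of_integral_sq_le {Y : Ω → ℝ} (hY : MemLp Y 2 P) {c : ℝ} (hc : 0 < c)
    (h : ∫ ω, Y ω ^ 2 ∂P ≤ c ^ 2) : ∫ ω, |Y ω| ∂P ≤ c := by
  have h1 : ∫ ω, |Y ω| ∂P ≤ ∫ ω, (c + Y ω ^ 2 / c) / 2 ∂P := by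
    refine integral_mono (hY.integrable one_le_two).abs
      (((integrable_const c).add (hY.integrable_sq.div_const c)).div_const 2) fun ω => ?_
    change |Y ω| ≤ (c + Y ω ^ 2 / c) / 2
    rw [le_div_iff₀ two_pos, ← sub_nonneg, ← sq_abs (Y ω)]
    have : c + |Y ω| ^ 2 / c - |Y ω| * 2 = (c - |Y ω|) ^ 2 / c := by field_simp; ring
    rw [this]
    positivity
  rw [integral_div, integral_add (integrable_const c) (hY.integrable_sq.div_const c),
    integral_div] at h1
  have h2 : (∫ ω, Y ω ^ 2 ∂P) / c ≤ c := by
    rw [div_le_iff₀ hc]; linarith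
  simp at h1
  linarith

/-- The deterministic estimate, taken at `y j = X j ω / √(r + 1)` and integrated. Orthogonality
bounds the linear sums in `L²`; the sums of squares differ from the full sum by `r` terms, which
cost at most `2 * r` in mean; third moments bound the Taylor error. -/
theorem norm_integral_sum_stein_le {X : ℕ → Ω → ℝ} (hX : ∀ j, MemLp (X j) 2 P)
    (hX3 : ∀ j, Integrable (fun ω => |X j ω| ^ 3) P)
    (horth : ∀ i j, ∫ ω, X i ω * X j ω ∂P = if i = j then 1 else 0) {M : ℝ}
    (hM : ∀ j, ∫ ω, |X j ω| ^ 3 ∂P ≤ M) {β : ℝ} (n r : ℕ) (hrn : r + 1 ≤ n)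
    (hβ : ∫ ω, |(∑ j ∈ Finset.range n, X j ω ^ 2) / n - 1| ∂P ≤ β) (u : ℝ) :
    ‖∫ ω, ∑ t ∈ slice n (r + 1), ((normSum X t ω : ℂ) - u * Complex.I) *
      Complex.exp (u * normSum X t ω * Complex.I) ∂P‖ ≤
      ((Finset.range n).powersetCard r).card * (√(n / (r + 1)) +
        |u| * ((n * β + 2 * r) / (r + 1)) +
        n * (3 * u ^ 2 * M / √(r + 1) ^ 3 + u ^ 2 / √(r + 1) ^ 3)) := by
  set K : ℝ := (r : ℝ) + 1 with hKdef
  have hK : 0 < K := by positivity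
  have hsK : 0 < √K := Real.sqrt_pos.2 hK
  have hn : (0 : ℝ) < n := by exact_mod_cast (show 0 < n by omega)
  have hsq : √K ^ 2 = K := Real.sq_sqrt hK.le
  set S := Finset.range n with hS
  have hpt : ∀ ω, ‖∑ t ∈ slice n (r + 1), ((normSum X t ω : ℂ) - u * Complex.I) *
      Complex.exp (u * normSum X t ω * Complex.I)‖ ≤
      ∑ s ∈ S.powersetCard r, (|∑ j ∈ S \ s, X j ω / √K| +
        |u| * |∑ j ∈ S \ s, ((X j ω / √K) ^ 2 - 1 / K)| +
        ∑ j ∈ S, (3 * u ^ 2 * |X j ω / √K| ^ 3 + u ^ 2 * |X j ω / √K| / K)) := by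
    intro ω
    refine le_of_eq_of_le ?_ (norm_sum_stein_le S r (fun j => X j ω / √K) u)
    congr 1
    refine Finset.sum_congr rfl fun t ht => ?_
    have : normSum X t ω = ∑ i ∈ t, X i ω / √K := by
      unfold normSum
      rw [← Finset.sum_div, (Finset.mem_powersetCard.1 ht).2, hKdef]
      push_cast
      rfl
    rw [← this]
    push_cast
    rfl
  have hsub : ∀ j, Integrable (fun ω => X j ω ^ 2 - 1) P := fun j =>
    (hX j).integrable_sq.sub (integrable_const 1)
  have hX2 : ∀ j, ∫ ω, X j ω ^ 2 ∂P = 1 := fun j => by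
    have := horth j j
    simpa [sq] using this
  have hsum2 : ∀ U : Finset ℕ, MemLp (fun ω => ∑ j ∈ U, X j ω / √K) 2 P := fun U => by
    have := memLp_sum_mul hX U fun _ => 1 / √K
    refine this.ae_eq (ae_of_all _ fun ω => ?_)
    exact Finset.sum_congr rfl fun j _ => by ring
  have i1 : ∀ U : Finset ℕ, Integrable (fun ω => |∑ j ∈ U, X j ω / √K|) P := fun U =>
    ((hsum2 U).integrable one_le_two).abs
  have e2 : ∀ (U : Finset ℕ) ω, |∑ j ∈ U, ((X j ω / √K) ^ 2 - 1 / K)| =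
      |∑ j ∈ U, (X j ω ^ 2 - 1)| / K := by
    intro U ω
    rw [← abs_of_pos hK, ← abs_div, abs_of_pos hK, Finset.sum_div]
    congr 1
    refine Finset.sum_congr rfl fun j _ => ?_
    rw [div_pow, hsq, sub_div]
  have i2' : ∀ U : Finset ℕ, Integrable (fun ω => |∑ j ∈ U, (X j ω ^ 2 - 1)|) P := fun U =>
    (integrable_finsetSum _ fun j _ => hsub j).abs
  have i2 : ∀ U : Finset ℕ, Integrable (fun ω => |u| * |∑ j ∈ U, ((X j ω / √K) ^ 2 - 1 / K)|) P :=
    fun U => by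
      simp_rw [e2]
      exact ((i2' U).div_const K).const_mul _
  have e3 : ∀ j ω, 3 * u ^ 2 * |X j ω / √K| ^ 3 + u ^ 2 * |X j ω / √K| / K =
      3 * u ^ 2 / √K ^ 3 * |X j ω| ^ 3 + u ^ 2 / √K ^ 3 * |X j ω| := by
    intro j ω
    rw [abs_div, abs_of_pos hsK, div_pow]
    have : u ^ 2 * (|X j ω| / √K) / K = u ^ 2 / √K ^ 3 * |X j ω| := by
      nth_rewrite 2 [← hsq]
      field_simp
    rw [this]; ring
  have i3a : ∀ j, Integrable (fun ω => 3 * u ^ 2 / √K ^ 3 * |X j ω| ^ 3) P := fun j =>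
    (hX3 j).const_mul _
  have i3b : ∀ j, Integrable (fun ω => u ^ 2 / √K ^ 3 * |X j ω|) P := fun j =>
    ((hX j).integrable one_le_two).abs.const_mul _
  have i3' : ∀ j, Integrable (fun ω =>
      3 * u ^ 2 * |X j ω / √K| ^ 3 + u ^ 2 * |X j ω / √K| / K) P := fun j => by
    simp_rw [e3]
    exact (i3a j).add (i3b j)
  have i3 : Integrable (fun ω =>
      ∑ j ∈ S, (3 * u ^ 2 * |X j ω / √K| ^ 3 + u ^ 2 * |X j ω / √K| / K)) P :=
    integrable_finsetSum _ fun j _ => i3' j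
  have i12 : ∀ U : Finset ℕ, Integrable (fun ω => |∑ j ∈ U, X j ω / √K| +
        |u| * |∑ j ∈ U, ((X j ω / √K) ^ 2 - 1 / K)|) P := fun U => (i1 U).add (i2 U)
  have i4 : ∀ U : Finset ℕ, Integrable (fun ω => |∑ j ∈ U, X j ω / √K| +
        |u| * |∑ j ∈ U, ((X j ω / √K) ^ 2 - 1 / K)| +
        ∑ j ∈ S, (3 * u ^ 2 * |X j ω / √K| ^ 3 + u ^ 2 * |X j ω / √K| / K)) P := fun U =>
    (i12 U).add i3
  refine (norm_integral_le_integral_norm _).trans ((integral_mono_of_nonneg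
    (ae_of_all _ fun ω => norm_nonneg _) (integrable_finsetSum _ fun s _ => i4 (S \ s))
    (ae_of_all _ hpt)).trans ?_)
  rw [integral_finsetSum _ fun s _ => i4 (S \ s), ← nsmul_eq_mul, ← Finset.sum_const]
  refine Finset.sum_le_sum fun s hs => ?_
  obtain ⟨hsS, hsc⟩ := Finset.mem_powersetCard.1 hs
  rw [integral_add (i12 _) i3, integral_add (i1 _) (i2 _), integral_const_mul]
  refine add_le_add (add_le_add ?_ (mul_le_mul_of_nonneg_left ?_ (abs_nonneg u))) ?_
  · refine integral_abs_le_of_integral_sq_le (hsum2 _) (by positivity) ?_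
    have h1 : ∀ ω, ∑ j ∈ S \ s, X j ω / √K = ∑ j ∈ S \ s, 1 / √K * X j ω := fun ω =>
      Finset.sum_congr rfl fun j _ => by ring
    simp_rw [h1]
    rw [integral_sum_mul_sq hX horth, Finset.sum_const, nsmul_eq_mul, Real.sq_sqrt (by positivity),
      div_pow, hsq, one_pow, mul_one_div]
    gcongr
    calc (S \ s).card ≤ S.card := Finset.card_le_card Finset.sdiff_subset
      _ = n := Finset.card_range n
  · simp_rw [e2]
    rw [integral_div]
    refine div_le_div_of_nonneg_right ?_ hK.le
    have h1 : ∀ ω, |∑ j ∈ S \ s, (X j ω ^ 2 - 1)| ≤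
        n * |(∑ j ∈ S, X j ω ^ 2) / n - 1| + ∑ j ∈ s, (X j ω ^ 2 + 1) := by
      intro ω
      have h2 : ∑ j ∈ S \ s, (X j ω ^ 2 - 1) =
          n * ((∑ j ∈ S, X j ω ^ 2) / n - 1) - ∑ j ∈ s, (X j ω ^ 2 - 1) := by
        rw [eq_sub_iff_add_eq, Finset.sum_sdiff hsS, Finset.sum_sub_distrib, Finset.sum_const,
          Finset.card_range, nsmul_eq_mul]
        field_simp
      rw [h2]
      refine (abs_sub _ _).trans (add_le_add ?_ ?_)
      · rw [abs_mul, abs_of_pos hn]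
      · refine (Finset.abs_sum_le_sum_abs _ _).trans (Finset.sum_le_sum fun j _ => ?_)
        rw [abs_le]
        constructor <;> nlinarith [sq_nonneg (X j ω)]
    have j1 : Integrable (fun ω => n * |(∑ j ∈ S, X j ω ^ 2) / n - 1|) P :=
      ((((integrable_finsetSum _ fun j _ => (hX j).integrable_sq).div_const _).sub
        (integrable_const 1)).abs).const_mul _
    have j2' : ∀ j, Integrable (fun ω => X j ω ^ 2 + 1) P := fun j =>
      (hX j).integrable_sq.add (integrable_const 1)
    have j2 : Integrable (fun ω => ∑ j ∈ s, (X j ω ^ 2 + 1)) P :=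
      integrable_finsetSum _ fun j _ => j2' j
    refine (integral_mono (i2' _) (j1.add j2) h1).trans ?_
    have h3 : ∫ ω, (n * |(∑ j ∈ S, X j ω ^ 2) / n - 1| + ∑ j ∈ s, (X j ω ^ 2 + 1)) ∂P =
        n * ∫ ω, |(∑ j ∈ S, X j ω ^ 2) / n - 1| ∂P + 2 * r := by
      rw [integral_add j1 j2, integral_const_mul, integral_finsetSum _ fun j _ => j2' j,
        Finset.sum_congr rfl fun j _ => by
          rw [integral_add (hX j).integrable_sq (integrable_const 1), hX2],
        Finset.sum_const, hsc, nsmul_eq_mul]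
      simp
      ring
    change ∫ ω, (n * |(∑ j ∈ S, X j ω ^ 2) / n - 1| + ∑ j ∈ s, (X j ω ^ 2 + 1)) ∂P ≤ _
    rw [h3]
    gcongr
  · rw [integral_finsetSum _ fun j _ => i3' j]
    have h1 : ∀ j ∈ S, ∫ ω, (3 * u ^ 2 * |X j ω / √K| ^ 3 + u ^ 2 * |X j ω / √K| / K) ∂P ≤
        3 * u ^ 2 * M / √K ^ 3 + u ^ 2 / √K ^ 3 := by
      intro j _
      simp_rw [e3]
      rw [integral_add (i3a j) (i3b j), integral_const_mul, integral_const_mul]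
      have h2 : ∫ ω, |X j ω| ∂P ≤ 1 :=
        integral_abs_le_of_integral_sq_le (hX j) one_pos (by rw [hX2]; norm_num)
      refine add_le_add ?_ ?_
      · rw [mul_div_right_comm (3 * u ^ 2) M]
        exact mul_le_mul_of_nonneg_left (hM j) (by positivity)
      · exact mul_le_of_le_one_right (by positivity) h2
    refine (Finset.sum_le_sum h1).trans_eq ?_
    rw [Finset.sum_const, Finset.card_range, nsmul_eq_mul]

end SteinIntegral

/-! ### Characteristic function of the average law -/

section AverageLaw

variable {Ω : Type*} [MeasurableSpace Ω] {P : Measure Ω} [IsProbabilityMeasure P]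

/-- The average of the laws of the normalized sums over all `k`-element subsets. -/
noncomputable def avgLaw (P : Measure Ω) (X : ℕ → Ω → ℝ) (n k : ℕ) : Measure ℝ :=
  ((slice n k).card : ENNReal)⁻¹ • ∑ t ∈ slice n k, P.map (normSum X t)

/-- The average of the distribution functions of the normalized sums. -/
noncomputable def avgCDF (P : Measure Ω) (X : ℕ → Ω → ℝ) (n k : ℕ) (x : ℝ) : ℝ :=
  (∑ t ∈ slice n k, sumCDF P X t x) / (slice n k).card

theorem slice_nonempty {n k : ℕ} (h : k ≤ n) : (slice n k).Nonempty :=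
  Finset.powersetCard_nonempty.2 (by simpa using h)

theorem isProbabilityMeasure_avgLaw {X : ℕ → Ω → ℝ} (hX : ∀ j, AEMeasurable (X j) P) {n k : ℕ}
    (h : k ≤ n) : IsProbabilityMeasure (avgLaw P X n k) := by
  have hc : ((slice n k).card : ENNReal) ≠ 0 := by
    exact_mod_cast (slice_nonempty h).card_pos.ne'
  constructor
  unfold avgLaw
  rw [Measure.smul_apply, Measure.finsetSum_apply]
  rw [Finset.sum_congr rfl fun t _ => by
    rw [Measure.map_apply_of_aemeasurable (aemeasurable_normSum hX t) MeasurableSet.univ,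
      Set.preimage_univ, measure_univ]]
  rw [Finset.sum_const, nsmul_eq_mul, mul_one, smul_eq_mul,
    ENNReal.inv_mul_cancel hc (ENNReal.natCast_ne_top _)]

theorem avgLaw_real_Iic {X : ℕ → Ω → ℝ} (hX : ∀ j, AEMeasurable (X j) P) (n k : ℕ) (x : ℝ) :
    (avgLaw P X n k).real (Set.Iic x) = avgCDF P X n k x := by
  unfold avgLaw avgCDF sumCDF
  rw [measureReal_def, Measure.smul_apply, Measure.finsetSum_apply, smul_eq_mul, ENNReal.toReal_mul,
    ENNReal.toReal_inv, ENNReal.toReal_natCast, div_eq_inv_mul, ENNReal.toReal_sum]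
  · congr 1
    refine Finset.sum_congr rfl fun t _ => ?_
    rw [Measure.map_apply_of_aemeasurable (aemeasurable_normSum hX t) measurableSet_Iic]
    rfl
  · intro t _
    rw [Measure.map_apply_of_aemeasurable (aemeasurable_normSum hX t) measurableSet_Iic]
    exact measure_ne_top _ _

theorem integrable_cexp_mul_I {f : Ω → ℝ} (hf : AEMeasurable f P) (u : ℝ) :
    Integrable (fun ω => Complex.exp (u * f ω * Complex.I)) P := by
  refine Integrable.of_bound ?_ 1 (ae_of_all _ fun ω => ?_)
  · have : Measurable fun x : ℝ => Complex.exp (u * x * Complex.I) := by fun_prop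
    exact (this.comp_aemeasurable hf).aestronglyMeasurable
  · rw [← Complex.ofReal_mul, Complex.norm_exp_ofReal_mul_I]

theorem charFun_avgLaw {X : ℕ → Ω → ℝ} (hX : ∀ j, AEMeasurable (X j) P) (n k : ℕ) (u : ℝ) :
    charFun (avgLaw P X n k) u =
      ((slice n k).card : ℂ)⁻¹ * ∑ t ∈ slice n k, charFun (P.map (normSum X t)) u := by
  have hint : ∀ t ∈ slice n k, Integrable (fun x : ℝ => Complex.exp (u * x * Complex.I))
      (P.map (normSum X t)) := fun t _ => by
    have := Measure.isProbabilityMeasure_map (aemeasurable_normSum (P := P) hX t)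
    exact integrable_cexp_mul_I aemeasurable_id u
  unfold avgLaw
  rw [charFun_apply_real, integral_smul_measure, integral_finsetSum_measure hint,
    ENNReal.toReal_inv, ENNReal.toReal_natCast]
  simp_rw [charFun_apply_real]
  rw [Complex.real_smul]
  push_cast
  rfl

theorem hasDerivAt_charFun_map {f : Ω → ℝ} (hf : MemLp f 2 P) (u : ℝ) :
    HasDerivAt (charFun (P.map f))
      (Complex.I * ∫ ω, (f ω : ℂ) * Complex.exp (u * f ω * Complex.I) ∂P) u := by
  have hm : AEMeasurable f P := hf.1.aemeasurable
  have := Measure.isProbabilityMeasure_map hm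
  have h1 : MemLp id ((1 : ℕ) : ENNReal) (P.map f) := by
    rw [memLp_map_measure_iff aestronglyMeasurable_id hm]
    exact hf.mono_exponent (by norm_num)
  have h2 := iteratedDeriv_charFun (t := u) h1
  rw [iteratedDeriv_one, pow_one] at h2
  have h3 := ((contDiff_charFun h1).differentiable (by norm_num) u).hasDerivAt
  rw [h2] at h3
  have h4 : ∫ x, (x : ℂ) ^ 1 * Complex.exp (u * x * Complex.I) ∂(P.map f) =
      ∫ ω, (f ω : ℂ) * Complex.exp (u * f ω * Complex.I) ∂P := by
    rw [integral_map hm (by fun_prop)]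
    simp
  rwa [h4] at h3

/-- Comparison of a function with the Gaussian characteristic function through the differential
equation satisfied by the latter. -/
theorem norm_sub_gaussian_le {φ φ' : ℝ → ℂ} (hφ : ∀ u, HasDerivAt φ (φ' u) u) (h0 : φ 0 = 1)
    {e : ℝ} (he : 0 ≤ e) (h : ∀ u, ‖φ' u + u * φ u‖ ≤ e * (1 + u ^ 2)) (u : ℝ) :
    ‖φ u - Complex.exp (-(u ^ 2 / 2))‖ ≤ e * (1 + u ^ 2) * |u| := by
  have hE : ∀ s : ℝ, HasDerivAt (fun s : ℝ => Complex.exp ((s : ℂ) ^ 2 / 2))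
      (Complex.exp ((s : ℂ) ^ 2 / 2) * s) s := by
    intro s
    have h1 : HasDerivAt (fun s : ℝ => (s : ℂ)) 1 s := Complex.ofRealCLM.hasDerivAt
    have h2 : HasDerivAt (fun s : ℝ => Complex.exp ((s : ℂ) ^ 2 / 2))
        (Complex.exp ((s : ℂ) ^ 2 / 2) * (((2 : ℕ) : ℂ) * (s : ℂ) ^ (2 - 1) * 1 / 2)) s :=
      ((h1.pow 2).div_const 2).cexp
    exact h2.congr_deriv (by push_cast; ring)
  -- The integrating factor `exp (s²/2)` turns the defect `φ' + s φ` into a derivative; the mean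
  -- value inequality then applies between 0 and `u`.
  have hψ : ∀ s : ℝ, HasDerivAt (fun s : ℝ => φ s * Complex.exp ((s : ℂ) ^ 2 / 2))
      ((φ' s + s * φ s) * Complex.exp ((s : ℂ) ^ 2 / 2)) s := by
    intro s
    exact ((hφ s).mul (hE s)).congr_deriv (by ring)
  have hnorm : ∀ s : ℝ, ‖Complex.exp ((s : ℂ) ^ 2 / 2)‖ = Real.exp (s ^ 2 / 2) := by
    intro s
    rw [Complex.norm_exp]
    congr 1
    have : ((s : ℂ) ^ 2 / 2) = ((s ^ 2 / 2 : ℝ) : ℂ) := by push_cast; rfl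
    rw [this, Complex.ofReal_re]
  have hb : ∀ s ∈ Set.uIcc 0 u, ‖(φ' s + s * φ s) * Complex.exp ((s : ℂ) ^ 2 / 2)‖ ≤
      e * (1 + u ^ 2) * Real.exp (u ^ 2 / 2) := by
    intro s hs
    have hsu : s ^ 2 ≤ u ^ 2 := by
      rw [sq_le_sq]
      have := Set.abs_sub_left_of_mem_uIcc hs
      simpa using this
    rw [norm_mul, hnorm]
    have := h s
    gcongr
    exact this.trans (by gcongr)
  have hmv := (convex_uIcc 0 u).norm_image_sub_le_of_norm_hasDerivWithin_le
    (fun s _ => (hψ s).hasDerivWithinAt) hb Set.left_mem_uIcc Set.right_mem_uIcc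
  have h1 : φ u - Complex.exp (-(u ^ 2 / 2)) =
      (φ u * Complex.exp ((u : ℂ) ^ 2 / 2) - φ 0 * Complex.exp (((0 : ℝ) : ℂ) ^ 2 / 2)) *
        Complex.exp (-(u ^ 2 / 2)) := by
    rw [sub_mul, mul_assoc, ← Complex.exp_add, h0]
    simp
  have hneg : ‖Complex.exp (-((u : ℂ) ^ 2 / 2))‖ = Real.exp (-(u ^ 2 / 2)) := by
    rw [Complex.exp_neg, norm_inv, hnorm, Real.exp_neg]
  rw [h1, norm_mul, hneg]
  refine (mul_le_mul_of_nonneg_right hmv (Real.exp_pos _).le).trans_eq ?_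
  rw [sub_zero, Real.norm_eq_abs]
  have : Real.exp (u ^ 2 / 2) * Real.exp (-(u ^ 2 / 2)) = 1 := by
    rw [← Real.exp_add]; simp
  calc e * (1 + u ^ 2) * Real.exp (u ^ 2 / 2) * |u| * Real.exp (-(u ^ 2 / 2))
      = e * (1 + u ^ 2) * |u| * (Real.exp (u ^ 2 / 2) * Real.exp (-(u ^ 2 / 2))) := by ring
    _ = _ := by rw [this, mul_one]

theorem norm_charFun_avgLaw_sub_le {X : ℕ → Ω → ℝ} (hX : ∀ j, MemLp (X j) 2 P)
    (hX3 : ∀ j, Integrable (fun ω => |X j ω| ^ 3) P)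
    (horth : ∀ i j, ∫ ω, X i ω * X j ω ∂P = if i = j then 1 else 0) {M : ℝ} (hM0 : 0 ≤ M)
    (hM : ∀ j, ∫ ω, |X j ω| ^ 3 ∂P ≤ M) {β : ℝ} (n k : ℕ) (hk : 1 ≤ k) (hkn : 2 * k ≤ n)
    (hβ : ∫ ω, |(∑ j ∈ Finset.range n, X j ω ^ 2) / n - 1| ∂P ≤ β) (u : ℝ) :
    ‖charFun (avgLaw P X n k) u - Complex.exp (-(u ^ 2 / 2))‖ ≤
      (2 * √(k / n) + 2 * β + 4 * (k / n) + (6 * M + 2) / √k) * (1 + u ^ 2) * |u| := by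
  obtain ⟨r, rfl⟩ : ∃ r, k = r + 1 := ⟨k - 1, by omega⟩
  have hm : ∀ j, AEMeasurable (X j) P := fun j => (hX j).1.aemeasurable
  have hβ0 : 0 ≤ β := (integral_nonneg fun _ => abs_nonneg _).trans hβ
  set N : ℝ := ((slice n (r + 1)).card : ℝ) with hN
  have hN0 : 0 < N := by
    rw [hN]; exact_mod_cast (slice_nonempty (by omega : r + 1 ≤ n)).card_pos
  have hprob := isProbabilityMeasure_avgLaw hm (by omega : r + 1 ≤ n)
  have hd : ∀ s : ℝ, HasDerivAt (charFun (avgLaw P X n (r + 1)))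
      ((N : ℂ)⁻¹ * ∑ t ∈ slice n (r + 1), Complex.I *
        ∫ ω, (normSum X t ω : ℂ) * Complex.exp (s * normSum X t ω * Complex.I) ∂P) s := by
    intro s
    have h1 : charFun (avgLaw P X n (r + 1)) = fun s =>
        (N : ℂ)⁻¹ * ∑ t ∈ slice n (r + 1), charFun (P.map (normSum X t)) s := by
      funext s
      rw [charFun_avgLaw hm, hN]
      push_cast
      rfl
    rw [h1]
    exact (HasDerivAt.fun_sum fun t _ => hasDerivAt_charFun_map (memLp_normSum hX t) s).const_mul _
  refine norm_sub_gaussian_le hd (by simp) (by positivity) ?_ u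
  intro u
  have hcalc : (N : ℂ)⁻¹ * ∑ t ∈ slice n (r + 1), Complex.I *
        ∫ ω, (normSum X t ω : ℂ) * Complex.exp (u * normSum X t ω * Complex.I) ∂P +
      u * charFun (avgLaw P X n (r + 1)) u =
      (N : ℂ)⁻¹ * (Complex.I * ∫ ω, ∑ t ∈ slice n (r + 1), ((normSum X t ω : ℂ) - u * Complex.I) *
      Complex.exp (u * normSum X t ω * Complex.I) ∂P) := by
    have i1 : ∀ t, Integrable (fun ω => Complex.exp (u * normSum X t ω * Complex.I)) P := fun t =>
      integrable_cexp_mul_I (aemeasurable_normSum hm t) u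
    have i2 : ∀ t, Integrable
        (fun ω => (normSum X t ω : ℂ) * Complex.exp (u * normSum X t ω * Complex.I)) P := by
      intro t
      refine Integrable.mul_bdd (c := 1) ((memLp_normSum hX t).integrable one_le_two).ofReal
        (i1 t).1 (ae_of_all _ fun ω => ?_)
      rw [← Complex.ofReal_mul, Complex.norm_exp_ofReal_mul_I]
    have i3 : ∀ t, Integrable (fun ω => ((normSum X t ω : ℂ) - u * Complex.I) *
        Complex.exp (u * normSum X t ω * Complex.I)) P := by
      intro t
      simp_rw [sub_mul]
      exact (i2 t).sub ((i1 t).const_mul _)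
    rw [integral_finsetSum _ fun t _ => i3 t, charFun_avgLaw hm, hN, Finset.mul_sum,
      Finset.mul_sum, Finset.mul_sum, Finset.mul_sum, Finset.mul_sum, ← Finset.sum_add_distrib]
    refine Finset.sum_congr rfl fun t _ => ?_
    simp_rw [sub_mul]
    rw [integral_sub (i2 t) ((i1 t).const_mul _), integral_const_mul, charFun_apply_real,
      integral_map (aemeasurable_normSum hm t) (by fun_prop)]
    push_cast
    linear_combination (((slice n (r + 1)).card : ℂ)⁻¹ * u *
      ∫ ω, Complex.exp (u * normSum X t ω * Complex.I) ∂P) * Complex.I_sq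
  rw [hcalc, norm_mul, norm_mul, Complex.norm_I, one_mul, norm_inv, Complex.norm_real,
    Real.norm_of_nonneg hN0.le, inv_mul_le_iff₀ hN0]
  refine (norm_integral_sum_stein_le hX hX3 horth hM n r (by omega) hβ u).trans ?_
  set m : ℝ := (((Finset.range n).powersetCard r).card : ℝ) with hmdef
  have hn : (0 : ℝ) < n := by exact_mod_cast (show 0 < n by omega)
  have hm0 : 0 ≤ m := by positivity
  have hNm : ((r : ℝ) + 1) * N = (n - r) * m := by
    have h := Nat.choose_succ_right_eq n r
    rw [hN, hmdef]
    unfold slice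
    rw [Finset.card_powersetCard, Finset.card_powersetCard, Finset.card_range]
    have h2 : ((n.choose (r + 1) * (r + 1) : ℕ) : ℝ) = ((n.choose r * (n - r) : ℕ) : ℝ) := by
      rw [h]
    push_cast [Nat.cast_sub (show r ≤ n by omega)] at h2
    linarith
  have hrn : 2 * ((r : ℝ) + 1) ≤ n := by exact_mod_cast hkn
  -- The ratio of binomial coefficients is `(r + 1) / (n - r)`, and `2 * k ≤ n` makes `n - r` at
  -- least `n / 2`.
  have hmN : m ≤ N * (2 * (r + 1) / n) := by
    have h1 : (n : ℝ) / 2 * m ≤ (r + 1) * N := by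
      rw [hNm]; gcongr; linarith
    rw [mul_div_assoc', le_div_iff₀ hn]
    linarith
  refine (mul_le_mul_of_nonneg_right hmN (by positivity)).trans ?_
  rw [mul_assoc]
  refine mul_le_mul_of_nonneg_left ?_ hN0.le
  push_cast
  set a := √(n : ℝ) with ha
  set b := √((r : ℝ) + 1) with hb
  have ha0 : 0 < a := Real.sqrt_pos.2 hn
  have hb0 : 0 < b := Real.sqrt_pos.2 (by positivity)
  have ha2 : (n : ℝ) = a ^ 2 := (Real.sq_sqrt hn.le).symm
  have hb2 : (r : ℝ) + 1 = b ^ 2 := (Real.sq_sqrt (by positivity)).symm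
  have e1 : √((n : ℝ) / (r + 1)) = a / b := by rw [Real.sqrt_div hn.le]
  have e2 : √(((r : ℝ) + 1) / n) = b / a := by rw [Real.sqrt_div (by positivity)]
  rw [e1, e2]
  have hr : (r : ℝ) ≤ b ^ 2 := by rw [← hb2]; linarith
  have h1 : 2 * ((r : ℝ) + 1) / n * (a / b + |u| * ((n * β + 2 * r) / (r + 1)) +
        n * (3 * u ^ 2 * M / b ^ 3 + u ^ 2 / b ^ 3)) ≤
      2 * (b / a) + |u| * (2 * β + 4 * ((r + 1) / n)) + u ^ 2 * ((6 * M + 2) / b) := by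
    rw [hb2, ha2]
    have : 2 * b ^ 2 / a ^ 2 * (a / b + |u| * ((a ^ 2 * β + 2 * r) / b ^ 2) +
        a ^ 2 * (3 * u ^ 2 * M / b ^ 3 + u ^ 2 / b ^ 3)) =
        2 * (b / a) + |u| * (2 * β + 4 * (r / a ^ 2)) + u ^ 2 * ((6 * M + 2) / b) := by
      field_simp
      ring
    rw [this]
    gcongr
  refine h1.trans ?_
  have hu : |u| ≤ 1 + u ^ 2 := by
    rw [← sq_abs]; nlinarith [sq_nonneg (|u| - 1), abs_nonneg u]
  have hu1 : (1 : ℝ) ≤ 1 + u ^ 2 := by linarith [sq_nonneg u]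
  have hu2 : u ^ 2 ≤ 1 + u ^ 2 := by linarith
  have k1 : 2 * (b / a) ≤ (1 + u ^ 2) * (2 * (b / a)) := le_mul_of_one_le_left (by positivity) hu1
  have k2 : |u| * (2 * β + 4 * (((r : ℝ) + 1) / n)) ≤
      (1 + u ^ 2) * (2 * β + 4 * ((r + 1) / n)) :=
    mul_le_mul_of_nonneg_right hu (by positivity)
  have k3 : u ^ 2 * ((6 * M + 2) / b) ≤ (1 + u ^ 2) * ((6 * M + 2) / b) :=
    mul_le_mul_of_nonneg_right hu2 (by positivity)
  linarith

/-- Scheffé's argument: the averages are nonnegative with mean one, so convergence to 1 in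
probability improves to convergence in `L¹`. -/
theorem tendsto_integral_abs_avg_sq_sub_one {X : ℕ → Ω → ℝ} (hX : ∀ j, MemLp (X j) 2 P)
    (horth : ∀ i j, ∫ ω, X i ω * X j ω ∂P = if i = j then 1 else 0)
    (hlim : TendstoInMeasure P
      (fun (n : ℕ) (ω : Ω) => (∑ j ∈ Finset.range n, X j ω ^ 2) / (n : ℝ)) atTop
      (fun _ => (1 : ℝ))) :
    Tendsto (fun n : ℕ => ∫ ω, |(∑ j ∈ Finset.range n, X j ω ^ 2) / n - 1| ∂P) atTop (𝓝 0) := by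
  rw [tendstoInMeasure_iff_measureReal_dist] at hlim
  have hX2 : ∀ j, ∫ ω, X j ω ^ 2 ∂P = 1 := fun j => by
    have := horth j j
    simpa [sq] using this
  have hv : ∀ n : ℕ, Integrable (fun ω => (∑ j ∈ Finset.range n, X j ω ^ 2) / (n : ℝ)) P :=
    fun n => (integrable_finsetSum _ fun j _ => (hX j).integrable_sq).div_const _
  have hbound : ∀ η : ℝ, 0 < η → ∀ n : ℕ, 1 ≤ n →
      ∫ ω, |(∑ j ∈ Finset.range n, X j ω ^ 2) / n - 1| ∂P ≤
        2 * η + 2 * P.real {ω | η ≤ dist ((∑ j ∈ Finset.range n, X j ω ^ 2) / (n : ℝ)) 1} := by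
    intro η hη n hn
    have hn0 : (n : ℝ) ≠ 0 := by positivity
    set v : Ω → ℝ := fun ω => (∑ j ∈ Finset.range n, X j ω ^ 2) / (n : ℝ) with hvdef
    have hmean : ∫ ω, v ω ∂P = 1 := by
      rw [hvdef, integral_div, integral_finsetSum _ fun j _ => (hX j).integrable_sq,
        Finset.sum_congr rfl fun j _ => hX2 j]
      simp [hn0]
    set A : Set Ω := {ω | η ≤ dist (v ω) 1} with hA
    have hAm : NullMeasurableSet A P := by
      refine AEMeasurable.nullMeasurableSet_preimage (f := fun ω => dist (v ω) 1)
        (s := Set.Ici η) ?_ measurableSet_Ici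
      exact (hv n).1.aemeasurable.dist aemeasurable_const
    have hv0 : ∀ ω, 0 ≤ v ω := fun ω =>
      div_nonneg (Finset.sum_nonneg fun _ _ => sq_nonneg _) (Nat.cast_nonneg n)
    -- `|x| = x + 2 x⁻`, where the negative part of `v - 1` is at most 1 on `A` and less than `η`
    -- off it; the first term has mean zero.
    have hpt : ∀ ω, |v ω - 1| ≤ (v ω - 1) + (2 * η + 2 * A.indicator (fun _ => (1 : ℝ)) ω) := by
      intro ω
      by_cases h : ω ∈ A
      · rw [Set.indicator_of_mem h, abs_le]
        constructor <;> linarith [hv0 ω]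
      · rw [Set.indicator_of_notMem h]
        have h' : |v ω - 1| < η := by
          rw [hA, Set.mem_ofPred_eq, not_le, Real.dist_eq] at h
          exact h
        have := (abs_lt.1 h').1
        rw [abs_le]
        constructor <;> linarith [le_abs_self (v ω - 1), (abs_lt.1 h').2]
    have iA : Integrable (A.indicator fun _ => (1 : ℝ)) P :=
      (integrable_const 1).indicator₀ hAm
    have i1 : Integrable (fun ω => v ω - 1) P := (hv n).sub (integrable_const 1)
    have i2 : Integrable (fun ω => 2 * η + 2 * A.indicator (fun _ => (1 : ℝ)) ω) P :=
      (integrable_const _).add (iA.const_mul 2)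
    refine (integral_mono i1.abs (i1.add i2) hpt).trans_eq ?_
    change ∫ ω, ((v ω - 1) + (2 * η + 2 * A.indicator (fun _ => (1 : ℝ)) ω)) ∂P = _
    rw [integral_add i1 i2, integral_sub (hv n) (integrable_const 1), hmean,
      integral_add (integrable_const _) (iA.const_mul 2), integral_const_mul 2
      (A.indicator fun _ => (1 : ℝ)), integral_indicator₀ hAm]
    simp
  rw [Metric.tendsto_atTop]
  intro e he
  obtain ⟨n₀, hn₀⟩ := Metric.tendsto_atTop.1 (hlim (e / 8) (by positivity)) (e / 8) (by positivity)
  refine ⟨max n₀ 1, fun n hn => ?_⟩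
  have h1 := hn₀ n (le_of_max_le_left hn)
  have h2 := hbound (e / 8) (by positivity) n (le_of_max_le_right hn)
  rw [Real.dist_eq, sub_zero, abs_of_nonneg (integral_nonneg fun _ => abs_nonneg _)]
  rw [Real.dist_eq, sub_zero] at h1
  have h3 := lt_of_abs_lt h1
  linarith

end AverageLaw

/-! ### The normal distribution function and a quantile grid -/

section NormalCDF

theorem stdNormalCDF_nonneg (x : ℝ) : 0 ≤ stdNormalCDF x := cdf_nonneg _ x

theorem stdNormalCDF_le_one (x : ℝ) : stdNormalCDF x ≤ 1 := cdf_le_one _ x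

theorem stdNormalCDF_mono : Monotone stdNormalCDF := monotone_cdf _

theorem gaussianPDFReal_zero_one_le (x : ℝ) : gaussianPDFReal 0 1 x ≤ 1 := by
  rw [gaussianPDFReal_def]
  have h1 : Real.exp (-(x - 0) ^ 2 / (2 * ((1 : NNReal) : ℝ))) ≤ 1 := by
    rw [Real.exp_le_one_iff]
    have := sq_nonneg (x - 0)
    simp only [NNReal.coe_one]
    linarith
  have h2 : (√(2 * Real.pi * ((1 : NNReal) : ℝ)))⁻¹ ≤ 1 := by
    refine inv_le_one_of_one_le₀ (Real.one_le_sqrt.2 ?_)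
    have := Real.pi_gt_three
    simp only [NNReal.coe_one]
    linarith
  exact mul_le_one₀ h2 (Real.exp_pos _).le h1

theorem stdNormalCDF_sub_le {x y : ℝ} (h : x ≤ y) : stdNormalCDF y ≤ stdNormalCDF x + (y - x) := by
  have h1 : stdNormalCDF y - stdNormalCDF x = (gaussianReal 0 1).real (Set.Ioc x y) := by
    unfold stdNormalCDF
    rw [cdf_eq_real, cdf_eq_real, ← measureReal_sdiff (Set.Iic_subset_Iic.2 h) measurableSet_Iic]
    congr 1
    ext z
    simp [and_comm]
  have h2 : (gaussianReal 0 1).real (Set.Ioc x y) ≤ y - x := by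
    rw [measureReal_def]
    refine ENNReal.toReal_le_of_le_ofReal (sub_nonneg.2 h) ?_
    rw [gaussianReal_apply 0 one_ne_zero]
    calc ∫⁻ z in Set.Ioc x y, gaussianPDF 0 1 z ≤ ∫⁻ _ in Set.Ioc x y, 1 := by
          refine lintegral_mono fun z => ?_
          unfold gaussianPDF
          exact ENNReal.ofReal_le_one.2 (gaussianPDFReal_zero_one_le z)
      _ = ENNReal.ofReal (y - x) := by simp
  linarith

theorem continuous_stdNormalCDF : Continuous stdNormalCDF := by
  have : LipschitzWith 1 stdNormalCDF := by
    refine LipschitzWith.of_le_add fun x y => ?_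
    rcases le_total x y with h | h
    · exact (stdNormalCDF_mono h).trans (le_add_of_nonneg_right dist_nonneg)
    · rw [Real.dist_eq, abs_of_nonneg (sub_nonneg.2 h)]
      exact stdNormalCDF_sub_le h
  exact this.continuous

theorem exists_stdNormalCDF_eq {q : ℝ} (h0 : 0 < q) (h1 : q < 1) : ∃ a, stdNormalCDF a = q := by
  obtain ⟨a, ha⟩ := ((tendsto_cdf_atBot (gaussianReal 0 1)).eventually_lt_const h0).exists
  obtain ⟨b, hb⟩ := ((tendsto_cdf_atTop (gaussianReal 0 1)).eventually_const_lt h1).exists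
  exact mem_range_of_exists_le_of_exists_ge continuous_stdNormalCDF ⟨a, ha.le⟩ ⟨b, hb.le⟩

/-- A finite grid on which the uniform distance to the normal distribution function is controlled,
made of quantiles. -/
theorem exists_quantile_grid (N : ℕ) (hN : 1 ≤ N) : ∃ A : Finset ℝ, A.card ≤ N ∧
    ∀ F : ℝ → ℝ, Monotone F → (∀ x, 0 ≤ F x) → (∀ x, F x ≤ 1) → ∀ s : ℝ, 0 ≤ s →
      (∀ a ∈ A, |F a - stdNormalCDF a| ≤ s) → ∀ x, |F x - stdNormalCDF x| ≤ s + 1 / N := by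
  have hN0 : (0 : ℝ) < N := by exact_mod_cast hN
  have hq : ∀ i : ℕ, ∃ a, 0 < i → i < N → stdNormalCDF a = i / N := by
    intro i
    by_cases h : 0 < i ∧ i < N
    · obtain ⟨a, ha⟩ := exists_stdNormalCDF_eq (q := i / N)
        (div_pos (by exact_mod_cast h.1) hN0) (by rw [div_lt_one hN0]; exact_mod_cast h.2)
      exact ⟨a, fun _ _ => ha⟩
    · exact ⟨0, fun h1 h2 => absurd ⟨h1, h2⟩ h⟩
  choose q hq using hq
  -- The point `q 0` is arbitrary and only keeps the indexing simple: levels 0 and 1 need no grid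
  -- point because `0 ≤ F ≤ 1`.
  refine ⟨(Finset.range N).image q, Finset.card_image_le.trans_eq (Finset.card_range N), ?_⟩
  intro F hF hF0 hF1 s hs hA x
  have hmem : ∀ i, i < N → |F (q i) - stdNormalCDF (q i)| ≤ s := fun i hi =>
    hA _ (Finset.mem_image_of_mem q (Finset.mem_range.2 hi))
  set p := N * stdNormalCDF x with hp
  have hp0 : 0 ≤ p := mul_nonneg hN0.le (stdNormalCDF_nonneg x)
  have hpN : p ≤ N := mul_le_of_le_one_right hN0.le (stdNormalCDF_le_one x)
  have hpx : stdNormalCDF x = p / N := by rw [hp]; field_simp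
  rw [abs_le]
  constructor
  · rcases le_or_gt ⌈p⌉₊ 1 with h | h
    · have h1 : p ≤ 1 := by exact_mod_cast Nat.ceil_le.1 h
      have h2 : p / N ≤ 1 / N := by gcongr
      linarith [hF0 x]
    · set j := ⌈p⌉₊ - 1 with hj
      have hjp : (j : ℝ) < p := Nat.lt_ceil.1 (by omega)
      have hpj : p ≤ j + 1 := by
        have := Nat.le_ceil p
        have h2 : ((⌈p⌉₊ : ℕ) : ℝ) = j + 1 := by
          rw [hj]; push_cast [Nat.cast_sub h.le]; ring
        linarith
      have hjN : j < N := by exact_mod_cast hjp.trans_le hpN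
      have e := hq j (by omega) hjN
      have hlt : stdNormalCDF (q j) < stdNormalCDF x := by
        rw [e, hpx]; gcongr
      have h3 := hF (stdNormalCDF_mono.reflect_lt hlt).le
      have h4 := (abs_le.1 (hmem j hjN)).1
      have h5 : p / N ≤ j / N + 1 / N := by rw [← add_div]; gcongr
      rw [e] at h4
      linarith
  · set j := ⌊p⌋₊ + 1 with hj
    have hpj : p < j := by rw [hj]; push_cast; exact Nat.lt_floor_add_one p
    have hjp : (j : ℝ) ≤ p + 1 := by
      rw [hj]; push_cast; linarith [Nat.floor_le hp0]
    have h5 : (j : ℝ) / N ≤ p / N + 1 / N := by rw [← add_div]; gcongr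
    rcases le_or_gt N j with h | h
    · have h1 : (1 : ℝ) ≤ j / N := by rw [one_le_div hN0]; exact_mod_cast h
      linarith [hF1 x]
    · have e := hq j (by omega) h
      have hlt : stdNormalCDF x < stdNormalCDF (q j) := by
        rw [e, hpx]; gcongr
      have h3 := hF (stdNormalCDF_mono.reflect_lt hlt).le
      have h4 := (abs_le.1 (hmem j h)).2
      rw [e] at h4
      linarith

theorem levyDist_stdNormalCDF_le {F : ℝ → ℝ} {s : ℝ} (hs : 0 ≤ s)
    (h : ∀ x, |F x - stdNormalCDF x| ≤ s) : levyDist F stdNormalCDF ≤ s := by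
  refine csInf_le ⟨0, fun _ hx => hx.1⟩ ⟨hs, fun x => ?_⟩
  have h1 := abs_le.1 (h x)
  have h2 := stdNormalCDF_mono (show x - s ≤ x by linarith)
  have h3 := stdNormalCDF_mono (show x ≤ x + s by linarith)
  constructor <;> linarith [h1.1, h1.2]

end NormalCDF

/-! ### Uniform convergence of the average distribution function -/

section AverageCDF

theorem sumCDF_nonneg {Ω : Type*} [MeasurableSpace Ω] {P : Measure Ω} (X : ℕ → Ω → ℝ)
    (t : Finset ℕ) (x : ℝ) : 0 ≤ sumCDF P X t x :=
  measureReal_nonneg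

theorem avgCDF_nonneg {Ω : Type*} [MeasurableSpace Ω] {P : Measure Ω} (X : ℕ → Ω → ℝ)
    (n k : ℕ) (x : ℝ) : 0 ≤ avgCDF P X n k x :=
  div_nonneg (Finset.sum_nonneg fun t _ => sumCDF_nonneg X t x) (Nat.cast_nonneg _)

theorem eventually_sparseRange : ∀ᶠ p in sparseRange, 1 ≤ p.2 ∧ p.2 ≤ p.1 :=
  (inf_le_right : sparseRange ≤ _) (mem_principal_self _)

variable {Ω : Type*} [MeasurableSpace Ω] {P : Measure Ω} [IsProbabilityMeasure P]

theorem sumCDF_le_one (X : ℕ → Ω → ℝ) (t : Finset ℕ) (x : ℝ) : sumCDF P X t x ≤ 1 :=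
  measureReal_le_one

theorem sumCDF_mono (X : ℕ → Ω → ℝ) (t : Finset ℕ) : Monotone (sumCDF P X t) :=
  fun _ _ h => measureReal_mono fun _ hω => le_trans hω h

theorem avgCDF_le_one (X : ℕ → Ω → ℝ) (n k : ℕ) (x : ℝ) : avgCDF P X n k x ≤ 1 := by
  refine div_le_one_of_le₀ ?_ (Nat.cast_nonneg _)
  refine (Finset.sum_le_sum fun t _ => sumCDF_le_one X t x).trans_eq ?_
  simp

theorem avgCDF_mono (X : ℕ → Ω → ℝ) (n k : ℕ) : Monotone (avgCDF P X n k) := fun _ _ h =>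
  div_le_div_of_nonneg_right (Finset.sum_le_sum fun t _ => sumCDF_mono X t h) (Nat.cast_nonneg _)

theorem abs_sub_stdNormalCDF_le_one {F : ℝ → ℝ} (h0 : ∀ x, 0 ≤ F x) (h1 : ∀ x, F x ≤ 1) (x : ℝ) :
    |F x - stdNormalCDF x| ≤ 1 := by
  rw [abs_le]
  constructor <;> linarith [h0 x, h1 x, stdNormalCDF_nonneg x, stdNormalCDF_le_one x]

theorem tendsto_fst_sparseRange : Tendsto (fun p : ℕ × ℕ => p.1) sparseRange atTop := by
  have h1 : Tendsto (fun p : ℕ × ℕ => p.2) sparseRange atTop :=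
    tendsto_comap.mono_left (inf_le_left.trans inf_le_left)
  exact tendsto_atTop_mono' _ (eventually_sparseRange.mono fun p hp => hp.2) h1

theorem tendsto_charFun_avgLaw {X : ℕ → Ω → ℝ} (hX : ∀ j, MemLp (X j) 2 P)
    (hX3 : ∀ j, Integrable (fun ω => |X j ω| ^ 3) P)
    (hbdd : BddAbove (Set.range fun j => ∫ ω, |X j ω| ^ 3 ∂P))
    (horth : ∀ i j, ∫ ω, X i ω * X j ω ∂P = if i = j then 1 else 0)
    (hlim : TendstoInMeasure P
      (fun (n : ℕ) (ω : Ω) => (∑ j ∈ Finset.range n, X j ω ^ 2) / (n : ℝ)) atTop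
      (fun _ => (1 : ℝ))) (u : ℝ) :
    Tendsto (fun p : ℕ × ℕ => charFun (avgLaw P X p.1 p.2) u) sparseRange
      (𝓝 (charFun (gaussianReal 0 1) u)) := by
  obtain ⟨M, hM⟩ := hbdd
  have hM' : ∀ j, ∫ ω, |X j ω| ^ 3 ∂P ≤ M := fun j => hM ⟨j, rfl⟩
  have hM0 : 0 ≤ M := (integral_nonneg fun ω => by positivity).trans (hM' 0)
  have hk : Tendsto (fun p : ℕ × ℕ => p.2) sparseRange atTop :=
    tendsto_comap.mono_left (inf_le_left.trans inf_le_left)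
  have hkn : Tendsto (fun p : ℕ × ℕ => (p.2 : ℝ) / (p.1 : ℝ)) sparseRange (𝓝 0) :=
    tendsto_comap.mono_left (inf_le_left.trans inf_le_right)
  have hβ := (tendsto_integral_abs_avg_sq_sub_one hX horth hlim).comp tendsto_fst_sparseRange
  have hsqrt : Tendsto (fun p : ℕ × ℕ => √((p.2 : ℝ) / (p.1 : ℝ))) sparseRange (𝓝 0) := by
    have := (Real.continuous_sqrt.tendsto 0).comp hkn
    rwa [Real.sqrt_zero] at this
  have hinv : Tendsto (fun p : ℕ × ℕ => (6 * M + 2) / √(p.2 : ℝ)) sparseRange (𝓝 0) :=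
    (tendsto_const_nhds).div_atTop
      (Real.tendsto_sqrt_atTop.comp (tendsto_natCast_atTop_atTop.comp hk))
  have he := ((((((hsqrt.const_mul 2).add (hβ.const_mul 2)).add (hkn.const_mul 4)).add
    hinv).mul_const (1 + u ^ 2)).mul_const |u|)
  simp only [mul_zero, add_zero, zero_mul] at he
  have hcf : charFun (gaussianReal 0 1) u = Complex.exp (-(u ^ 2 / 2)) := by
    rw [charFun_gaussianReal]
    congr 1
    simp
  rw [hcf, tendsto_iff_norm_sub_tendsto_zero]
  refine squeeze_zero' (Eventually.of_forall fun _ => norm_nonneg _) ?_ he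
  filter_upwards [eventually_sparseRange, hkn.eventually_lt_const (show (0 : ℝ) < 1 / 2 by norm_num)] with p hp hp2
  refine norm_charFun_avgLaw_sub_le hX hX3 horth hM0 hM' p.1 p.2 hp.1 ?_ le_rfl u
  have hn0 : (0 : ℝ) < p.1 := by exact_mod_cast hp.1.trans hp.2
  rw [div_lt_iff₀ hn0] at hp2
  have : 2 * (p.2 : ℝ) ≤ p.1 := by linarith
  exact_mod_cast this

theorem tendsto_avgCDF {X : ℕ → Ω → ℝ} (hX : ∀ j, AEMeasurable (X j) P)
    (h : ∀ u, Tendsto (fun p : ℕ × ℕ => charFun (avgLaw P X p.1 p.2) u) sparseRange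
      (𝓝 (charFun (gaussianReal 0 1) u))) (x : ℝ) :
    Tendsto (fun p : ℕ × ℕ => avgCDF P X p.1 p.2 x) sparseRange (𝓝 (stdNormalCDF x)) := by
  have hcg : sparseRange.IsCountablyGenerated := by
    unfold sparseRange
    infer_instance
  -- Countable generation of the filter reduces the limit to sequences of pairs, for which Lévy's
  -- continuity theorem applies. Pairs with `k > n`, where the average law is not a probability
  -- measure, receive the Gaussian as a default.
  refine tendsto_of_seq_tendsto fun p hp => ?_
  have hr : ∀ᶠ i in atTop, (p i).2 ≤ (p i).1 := hp.eventually
    (eventually_sparseRange.mono fun _ h => h.2)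
  let γ : ProbabilityMeasure ℝ := ⟨gaussianReal 0 1, inferInstance⟩
  let ν : ℕ → ProbabilityMeasure ℝ := fun i => if h : (p i).2 ≤ (p i).1 then
    ⟨avgLaw P X (p i).1 (p i).2, isProbabilityMeasure_avgLaw hX h⟩ else γ
  have hν : ∀ᶠ i in atTop, (ν i : Measure ℝ) = avgLaw P X (p i).1 (p i).2 :=
    hr.mono fun i hi => by simp [ν, hi]
  have hlim : Tendsto ν atTop (𝓝 γ) := by
    rw [ProbabilityMeasure.tendsto_iff_tendsto_charFun]
    intro u
    exact ((h u).comp hp).congr' (hν.mono fun i hi => by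
      simp only [Function.comp_apply, hi])
  have hna := nullSingletonClass_gaussianReal (μ := 0) (v := 1) one_ne_zero
  have h1 := ProbabilityMeasure.tendsto_measure_of_null_frontier_of_tendsto' hlim
    (E := Set.Iic x) (by
      change gaussianReal 0 1 _ = 0
      rw [frontier_Iic]
      exact measure_singleton x)
  have h2 := (ENNReal.tendsto_toReal (measure_ne_top (gaussianReal 0 1) (Set.Iic x))).comp h1
  have h3 : ((gaussianReal 0 1) (Set.Iic x)).toReal = stdNormalCDF x := by
    unfold stdNormalCDF
    rw [cdf_eq_real]
    rfl
  rw [h3] at h2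
  refine h2.congr' (hν.mono fun i hi => ?_)
  change ((ν i : Measure ℝ) (Set.Iic x)).toReal = avgCDF P X (p i).1 (p i).2 x
  rw [hi, ← avgLaw_real_Iic hX]
  rfl

/-- The uniform distance between the average distribution function and the normal one. -/
noncomputable def avgNormalDist (P : Measure Ω) (X : ℕ → Ω → ℝ) (p : ℕ × ℕ) : ℝ :=
  ⨆ x, |avgCDF P X p.1 p.2 x - stdNormalCDF x|

theorem abs_avgCDF_sub_le (X : ℕ → Ω → ℝ) (n k : ℕ) (x : ℝ) :
    |avgCDF P X n k x - stdNormalCDF x| ≤ avgNormalDist P X (n, k) := by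
  refine le_ciSup (f := fun x => |avgCDF P X n k x - stdNormalCDF x|) ⟨1, ?_⟩ x
  rintro _ ⟨y, rfl⟩
  exact abs_sub_stdNormalCDF_le_one (avgCDF_nonneg X n k) (avgCDF_le_one X n k) y

theorem avgNormalDist_nonneg (X : ℕ → Ω → ℝ) (n k : ℕ) : 0 ≤ avgNormalDist P X (n, k) :=
  (abs_nonneg _).trans (abs_avgCDF_sub_le X n k 0)

/-- Pólya's theorem: for monotone functions, convergence at finitely many quantiles of the
continuous limit already controls the uniform distance. -/
theorem tendsto_avgNormalDist {X : ℕ → Ω → ℝ}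
    (h : ∀ x, Tendsto (fun p : ℕ × ℕ => avgCDF P X p.1 p.2 x) sparseRange (𝓝 (stdNormalCDF x))) :
    Tendsto (avgNormalDist P X) sparseRange (𝓝 0) := by
  rw [Metric.tendsto_nhds]
  intro η hη
  obtain ⟨N, hN⟩ := exists_nat_one_div_lt (show 0 < η / 2 by positivity)
  obtain ⟨A, -, hA⟩ := exists_quantile_grid (N + 1) (by omega)
  have hev : ∀ᶠ p in sparseRange, ∀ a ∈ A, |avgCDF P X p.1 p.2 a - stdNormalCDF a| ≤ η / 2 := by
    rw [Filter.eventually_all_finset]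
    intro a _
    have := Metric.tendsto_nhds.1 (h a) (η / 2) (by positivity)
    exact this.mono fun p hp => by rw [Real.dist_eq] at hp; exact hp.le
  filter_upwards [hev] with p hp
  rw [Real.dist_eq, sub_zero, abs_of_nonneg (avgNormalDist_nonneg X p.1 p.2)]
  have h1 : avgNormalDist P X p ≤ η / 2 + 1 / ((N + 1 : ℕ) : ℝ) := ciSup_le fun x =>
    hA _ (avgCDF_mono X p.1 p.2) (avgCDF_nonneg X p.1 p.2) (avgCDF_le_one X p.1 p.2) (η / 2)
      (by positivity) hp x
  push_cast at h1
  linarith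

end AverageCDF

/-! ### Deviations of the distribution functions and the theorem -/

section Deviations

variable {Ω : Type*} [MeasurableSpace Ω] {P : Measure Ω} [IsProbabilityMeasure P]

theorem integrable_comp_normSum {X : ℕ → Ω → ℝ} (hX : ∀ j, AEMeasurable (X j) P) {g : ℝ → ℝ}
    (hg : Continuous g) (h0 : ∀ y, 0 ≤ g y) (h1 : ∀ y, g y ≤ 1) (t : Finset ℕ) :
    Integrable (fun ω => g (normSum X t ω)) P :=
  Integrable.of_bound (hg.measurable.comp_aemeasurable
    (aemeasurable_normSum hX t)).aestronglyMeasurable 1 (ae_of_all _ fun ω => by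
      rw [Real.norm_of_nonneg (h0 _)]; exact h1 _)

theorem integral_indicator_normSum {X : ℕ → Ω → ℝ} (hX : ∀ j, AEMeasurable (X j) P)
    (t : Finset ℕ) (a : ℝ) :
    Integrable ({ω | normSum X t ω ≤ a}.indicator fun _ => (1 : ℝ)) P ∧
      ∫ ω, {ω | normSum X t ω ≤ a}.indicator (fun _ => (1 : ℝ)) ω ∂P = sumCDF P X t a := by
  have hm : NullMeasurableSet {ω | normSum X t ω ≤ a} P :=
    nullMeasurableSet_le (aemeasurable_normSum hX t) aemeasurable_const
  refine ⟨(integrable_const 1).indicator₀ hm, ?_⟩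
  rw [integral_indicator₀ hm]
  simp [sumCDF]

theorem sumCDF_le_integral {X : ℕ → Ω → ℝ} (hX : ∀ j, AEMeasurable (X j) P) {g : ℝ → ℝ}
    (hg : Continuous g) (h0 : ∀ y, 0 ≤ g y) (h1 : ∀ y, g y ≤ 1) {a : ℝ}
    (ha : ∀ y, y ≤ a → g y = 1) (t : Finset ℕ) :
    sumCDF P X t a ≤ ∫ ω, g (normSum X t ω) ∂P := by
  obtain ⟨hi, he⟩ := integral_indicator_normSum (P := P) hX t a
  rw [← he]
  refine integral_mono hi (integrable_comp_normSum hX hg h0 h1 t) fun ω => ?_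
  by_cases h : ω ∈ {ω | normSum X t ω ≤ a}
  · rw [Set.indicator_of_mem h, ha _ h]
  · rw [Set.indicator_of_notMem h]; exact h0 _

theorem integral_le_sumCDF {X : ℕ → Ω → ℝ} (hX : ∀ j, AEMeasurable (X j) P) {g : ℝ → ℝ}
    (hg : Continuous g) (h0 : ∀ y, 0 ≤ g y) (h1 : ∀ y, g y ≤ 1) {a : ℝ}
    (ha : ∀ y, a ≤ y → g y = 0) (t : Finset ℕ) :
    ∫ ω, g (normSum X t ω) ∂P ≤ sumCDF P X t a := by
  obtain ⟨hi, he⟩ := integral_indicator_normSum (P := P) hX t a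
  rw [← he]
  refine integral_mono (integrable_comp_normSum hX hg h0 h1 t) hi fun ω => ?_
  by_cases h : ω ∈ {ω | normSum X t ω ≤ a}
  · rw [Set.indicator_of_mem h]; exact h1 _
  · rw [Set.indicator_of_notMem h, ha _ (not_le.1 h).le]

/-- At a fixed point, the distribution functions deviate from the average one, up to a shift of the
argument, with Gaussian tails. -/
theorem exists_card_deviation_le : ∃ c : ℝ, 0 < c ∧ ∀ {Ω : Type*} [MeasurableSpace Ω]
    {P : Measure Ω} [IsProbabilityMeasure P] {X : ℕ → Ω → ℝ}, (∀ j, MemLp (X j) 2 P) →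
    (∀ i j, ∫ ω, X i ω * X j ω ∂P = if i = j then 1 else 0) →
    ∀ {n k : ℕ}, 1 ≤ k → k ≤ n → ∀ {h : ℝ}, 0 < h → h ≤ 1 → ∀ a : ℝ,
      (((slice n k).filter fun t => avgCDF P X n k (a + h) + h ≤ sumCDF P X t a ∨
        sumCDF P X t a ≤ avgCDF P X n k (a - h) - h).card : ℝ) ≤
        (slice n k).card * (2 * Real.exp (-(c * k * h ^ 6))) := by
  obtain ⟨K, hK0, φ, φ', hφ, hφ', h0, h1, hl, hr, hb, ht⟩ := exists_smooth_step
  refine ⟨1 / (128 * K ^ 2), by positivity, ?_⟩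
  intro Ω _ P _ X hX horth n k hk hkn h hh hh1 a
  have hm : ∀ j, AEMeasurable (X j) P := fun j => (hX j).1.aemeasurable
  set N : ℝ := ((slice n k).card : ℝ) with hN
  have hN0 : 0 < N := by rw [hN]; exact_mod_cast (slice_nonempty hkn).card_pos
  -- A smooth majorant of the indicator of `y ≤ b` and minorant of that of `y ≤ b + h`. Upward
  -- deviations at `a` use `g a`, downward ones `-g (a - h)`.
  set g : ℝ → ℝ → ℝ := fun b y => φ ((b + h - y) / h) with hg
  have gc : ∀ b, Continuous (g b) := fun b => hφ.comp (by fun_prop)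
  have g'c : ∀ b, Continuous fun y => -(φ' ((b + h - y) / h)) / h := fun b =>
    ((hφ'.comp (by fun_prop)).neg).div_const h
  have g'b : ∀ b y, |-(φ' ((b + h - y) / h)) / h| ≤ K / h := fun b y => by
    rw [abs_div, abs_neg, abs_of_pos hh]
    gcongr
    exact hb _
  have gone : ∀ b y, y ≤ b → g b y = 1 := fun b y hy => hr _ (by
    rw [le_div_iff₀ hh]; linarith)
  have gzero : ∀ b y, b + h ≤ y → g b y = 0 := fun b y hy => hl _
    (div_nonpos_of_nonpos_of_nonneg (by linarith) hh.le)
  have gt : ∀ b y s, |g b (y + s) - g b y - -(φ' ((b + h - y) / h)) / h * s| ≤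
      K / h ^ 2 * s ^ 2 := by
    intro b y s
    have := ht ((b + h - y) / h) (-s / h)
    have e1 : (b + h - y) / h + -s / h = (b + h - (y + s)) / h := by ring
    rw [e1] at this
    refine le_of_eq_of_le ?_ (this.trans_eq (by ring))
    congr 1
    ring
  have habs : ∀ b y, |g b y| ≤ 1 := fun b y => by
    rw [abs_of_nonneg (h0 _)]; exact h1 _
  -- The Taylor constant `K / h ^ 2` dominates since `h ≤ 1`; its square turns `h ^ 2` into `h ^ 6`.
  have hexp : Real.exp (-(k * h ^ 2 / (64 * ((K / h) ^ 2 + (K / h ^ 2) ^ 2)))) ≤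
      Real.exp (-(1 / (128 * K ^ 2) * k * h ^ 6)) := by
    rw [Real.exp_le_exp, neg_le_neg_iff]
    have hle : (K / h) ^ 2 + (K / h ^ 2) ^ 2 ≤ 2 * (K ^ 2 / h ^ 4) := by
      have e1 : (K / h) ^ 2 = h ^ 2 * (K ^ 2 / h ^ 4) := by field_simp
      have e2 : (K / h ^ 2) ^ 2 = K ^ 2 / h ^ 4 := by ring
      rw [e1, e2]
      have : h ^ 2 ≤ 1 := pow_le_one₀ hh.le hh1
      have h3 : h ^ 2 * (K ^ 2 / h ^ 4) ≤ 1 * (K ^ 2 / h ^ 4) := by gcongr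
      linarith
    calc 1 / (128 * K ^ 2) * k * h ^ 6 = k * h ^ 2 / (64 * (2 * (K ^ 2 / h ^ 4))) := by
          field_simp; norm_num
      _ ≤ _ := by gcongr
  have hupper := card_filter_integral_normSum_le hX horth (gc a) (g'c a) (habs a) (g'b a)
    (by positivity) (gt a) hk hkn hh
  have hlower := card_filter_integral_normSum_le hX horth (g := fun y => -g (a - h) y)
    (g' := fun y => -(-(φ' ((a - h + h - y) / h)) / h)) (gc (a - h)).neg (g'c (a - h)).neg
    (fun y => by rw [abs_neg]; exact habs (a - h) y)
    (fun y => by rw [abs_neg]; exact g'b (a - h) y) (K := K / h ^ 2)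
    (by positivity) (fun y s => by
      refine le_of_eq_of_le ?_ (gt (a - h) y s)
      rw [← abs_neg]
      congr 1
      ring) hk hkn hh
  have hsub : ((slice n k).filter fun t => avgCDF P X n k (a + h) + h ≤ sumCDF P X t a ∨
      sumCDF P X t a ≤ avgCDF P X n k (a - h) - h) ⊆
      ((slice n k).filter fun t => (∑ t ∈ slice n k, ∫ ω, g a (normSum X t ω) ∂P) /
        (slice n k).card + h ≤ ∫ ω, g a (normSum X t ω) ∂P) ∪
      ((slice n k).filter fun t => (∑ t ∈ slice n k, ∫ ω, -g (a - h) (normSum X t ω) ∂P) /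
        (slice n k).card + h ≤ ∫ ω, -g (a - h) (normSum X t ω) ∂P) := by
    intro t ht
    obtain ⟨hts, hcase⟩ := Finset.mem_filter.1 ht
    rw [Finset.mem_union, Finset.mem_filter, Finset.mem_filter]
    rcases hcase with hcase | hcase
    · refine Or.inl ⟨hts, ?_⟩
      have e1 := sumCDF_le_integral (P := P) hm (gc a) (fun y => h0 _) (fun y => h1 _) (gone a) t
      have e2 : (∑ t ∈ slice n k, ∫ ω, g a (normSum X t ω) ∂P) / (slice n k).card ≤
          avgCDF P X n k (a + h) :=
        div_le_div_of_nonneg_right (Finset.sum_le_sum fun t _ => integral_le_sumCDF hm (gc a)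
          (fun y => h0 _) (fun y => h1 _) (gzero a) t) (Nat.cast_nonneg _)
      linarith
    · refine Or.inr ⟨hts, ?_⟩
      have e1 := integral_le_sumCDF (P := P) hm (gc (a - h)) (fun y => h0 _) (fun y => h1 _)
        (gzero (a - h)) t
      rw [sub_add_cancel] at e1
      have e2 : avgCDF P X n k (a - h) ≤
          (∑ t ∈ slice n k, ∫ ω, g (a - h) (normSum X t ω) ∂P) / (slice n k).card :=
        div_le_div_of_nonneg_right (Finset.sum_le_sum fun t _ => sumCDF_le_integral hm
          (gc (a - h)) (fun y => h0 _) (fun y => h1 _) (gone (a - h)) t) (Nat.cast_nonneg _)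
      simp_rw [integral_neg]
      rw [Finset.sum_neg_distrib, neg_div]
      linarith
  have hcard : (((slice n k).filter fun t => avgCDF P X n k (a + h) + h ≤ sumCDF P X t a ∨
      sumCDF P X t a ≤ avgCDF P X n k (a - h) - h).card : ℝ) ≤ _ :=
    Nat.cast_le.2 ((Finset.card_le_card hsub).trans (Finset.card_union_le _ _))
  refine hcard.trans ?_
  push_cast
  refine (add_le_add hupper hlower).trans ?_
  have := mul_le_mul_of_nonneg_left hexp hN0.le
  rw [← hN]
  linarith

theorem sliceMeasure_le_of_subset {n k : ℕ} (hkn : k ≤ n) {B : Set (Finset ℕ)}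
    {A : Finset (Finset ℕ)} (h : ∀ t ∈ slice n k, t ∈ B → t ∈ A) {q : ℝ}
    (hA : (A.card : ℝ) ≤ (slice n k).card * q) : sliceMeasure n k B ≤ q := by
  have hN0 : (0 : ℝ) < (slice n k).card := by exact_mod_cast (slice_nonempty hkn).card_pos
  unfold sliceMeasure
  rw [div_le_iff₀ hN0, mul_comm]
  refine le_trans ?_ hA
  have h1 : (B ∩ (slice n k : Set (Finset ℕ))).ncard ≤ A.card := by
    rw [← Set.ncard_coe_finset]
    exact Set.ncard_le_ncard (fun t ht => h t ht.2 ht.1) A.finite_toSet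
  exact_mod_cast h1

theorem sliceMeasure_le_one {n k : ℕ} (hkn : k ≤ n) (B : Set (Finset ℕ)) :
    sliceMeasure n k B ≤ 1 :=
  sliceMeasure_le_of_subset hkn (A := slice n k) (fun _ ht _ => ht) (by rw [mul_one])

theorem exists_sliceMeasure_levyDist_le : ∃ c : ℝ, 0 < c ∧ ∀ {Ω : Type*} [MeasurableSpace Ω]
    {P : Measure Ω} [IsProbabilityMeasure P] {X : ℕ → Ω → ℝ}, (∀ j, MemLp (X j) 2 P) →
    (∀ i j, ∫ ω, X i ω * X j ω ∂P = if i = j then 1 else 0) →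
    ∀ {n k : ℕ}, 1 ≤ k → k ≤ n → ∀ {δ : ℝ}, 0 < δ → δ ≤ 1 →
      sliceMeasure n k {τ | ¬ levyDist (sumCDF P X τ) stdNormalCDF <
        δ + avgNormalDist P X (n, k)} ≤ 10 / δ * Real.exp (-(c * k * δ ^ 6)) := by
  obtain ⟨c, hc, hdev⟩ := exists_card_deviation_le
  refine ⟨c / 4 ^ 6, by positivity, ?_⟩
  intro Ω _ P _ X hX horth n k hk hkn δ hδ hδ1
  set ε := avgNormalDist P X (n, k) with hε
  have hε0 : 0 ≤ ε := avgNormalDist_nonneg X n k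
  -- Off the exceptional set the error is `h` from the deviation, `h` from shifting the argument of
  -- the 1-Lipschitz `Φ`, and `1 / N ≤ h` from the grid. The total `3 * h` stays strictly below `δ`.
  set h := δ / 4 with hh
  have hh0 : 0 < h := by positivity
  set N := ⌈4 / δ⌉₊ with hNdef
  have hN1 : 1 ≤ N := Nat.one_le_iff_ne_zero.2 (Nat.ceil_pos.2 (by positivity)).ne'
  have hN0 : (0 : ℝ) < N := by exact_mod_cast hN1
  have hNinv : (1 : ℝ) / N ≤ h := by
    rw [div_le_iff₀ hN0, hh]
    have h1 : 4 / δ ≤ N := Nat.le_ceil _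
    rw [div_le_iff₀ hδ] at h1
    linarith
  have hNle : (N : ℝ) ≤ 5 / δ := by
    have h1 : (N : ℝ) < 4 / δ + 1 := Nat.ceil_lt_add_one (by positivity)
    have h2 : (1 : ℝ) ≤ 1 / δ := by rw [le_div_iff₀ hδ]; linarith
    have h3 : 5 / δ = 4 / δ + 1 / δ := by ring
    linarith
  obtain ⟨A, hAcard, hA⟩ := exists_quantile_grid N hN1
  refine sliceMeasure_le_of_subset hkn (A := A.biUnion fun a => (slice n k).filter fun t =>
    avgCDF P X n k (a + h) + h ≤ sumCDF P X t a ∨ sumCDF P X t a ≤ avgCDF P X n k (a - h) - h)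
    ?_ ?_
  · intro t ht hbad
    by_contra hgood
    refine hbad ?_
    have hgrid : ∀ a ∈ A, |sumCDF P X t a - stdNormalCDF a| ≤ 2 * h + ε := by
      intro a ha
      have hn : ¬ (avgCDF P X n k (a + h) + h ≤ sumCDF P X t a ∨
          sumCDF P X t a ≤ avgCDF P X n k (a - h) - h) := fun hcase =>
        hgood (Finset.mem_biUnion.2 ⟨a, ha, Finset.mem_filter.2 ⟨ht, hcase⟩⟩)
      rw [not_or, not_le, not_le] at hn
      have e1 := (abs_le.1 (abs_avgCDF_sub_le (P := P) X n k (a + h))).2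
      have e2 := (abs_le.1 (abs_avgCDF_sub_le (P := P) X n k (a - h))).1
      have e3 := stdNormalCDF_sub_le (show a ≤ a + h by linarith)
      have e4 := stdNormalCDF_sub_le (show a - h ≤ a by linarith)
      rw [abs_le]
      constructor <;> linarith [hn.1, hn.2]
    have hall := hA _ (sumCDF_mono X t) (sumCDF_nonneg X t) (sumCDF_le_one X t) (2 * h + ε)
      (by positivity) hgrid
    have hL := levyDist_stdNormalCDF_le (by positivity) hall
    linarith
  · have h1 : ((A.biUnion fun a => (slice n k).filter fun t =>
        avgCDF P X n k (a + h) + h ≤ sumCDF P X t a ∨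
          sumCDF P X t a ≤ avgCDF P X n k (a - h) - h).card : ℝ) ≤
        ∑ a ∈ A, (slice n k).card * (2 * Real.exp (-(c * k * h ^ 6))) := by
      refine le_trans (Nat.cast_le.2 Finset.card_biUnion_le) ?_
      push_cast
      exact Finset.sum_le_sum fun a _ => hdev hX horth hk hkn hh0 (by rw [hh]; linarith) a
    refine h1.trans ?_
    rw [Finset.sum_const, nsmul_eq_mul]
    have h2 : (A.card : ℝ) ≤ 5 / δ := le_trans (by exact_mod_cast hAcard) hNle
    have h3 : c * k * h ^ 6 = c / 4 ^ 6 * k * δ ^ 6 := by rw [hh]; ring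
    rw [h3]
    calc (A.card : ℝ) * ((slice n k).card * (2 * Real.exp (-(c / 4 ^ 6 * k * δ ^ 6))))
        ≤ 5 / δ * ((slice n k).card * (2 * Real.exp (-(c / 4 ^ 6 * k * δ ^ 6)))) := by gcongr
      _ = _ := by ring

/-- Absorbs the size of the quantile grid into the prefactor: `1/δ ≤ δ⁻⁶ = (δ⁻⁸)^(3/4)`. -/
theorem inv_le_rpow_of_one_le {k δ : ℝ} (hδ : 0 < δ) (hδ1 : δ ≤ 1) (h : 1 ≤ k * δ ^ 8) :
    1 / δ ≤ k ^ (3 / 4 : ℝ) := by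
  have hinv : 1 ≤ 1 / δ := by rw [le_div_iff₀ hδ]; linarith
  have h1 : (1 / δ) ^ 8 ≤ k := by
    rw [div_pow, one_pow, div_le_iff₀ (by positivity)]
    exact h
  calc 1 / δ ≤ (1 / δ) ^ 6 := le_self_pow₀ hinv (by norm_num)
    _ = ((1 / δ) ^ 8) ^ (3 / 4 : ℝ) := by
        rw [← Real.rpow_natCast, ← Real.rpow_natCast, ← Real.rpow_mul (by positivity)]
        norm_num
    _ ≤ k ^ (3 / 4 : ℝ) := Real.rpow_le_rpow (by positivity) h1 (by norm_num)

end Deviations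

theorem theorem1p2 :
    ∃ C c : ℝ, 0 < C ∧ 0 < c ∧
      ∀ (Ω : Type*) [MeasurableSpace Ω] (P : Measure Ω) [IsProbabilityMeasure P]
        (X : ℕ → Ω → ℝ),
        (∀ j, AEMeasurable (X j) P) →
        (∀ j, Integrable (fun ω => |X j ω| ^ 3) P) →
        BddAbove (Set.range fun j => ∫ ω, |X j ω| ^ 3 ∂P) →
        (∀ j, ∫ ω, X j ω ∂P = 0) →
        (∀ i j, ∫ ω, X i ω * X j ω ∂P = if i = j then 1 else 0) →
        TendstoInMeasure P
          (fun (n : ℕ) (ω : Ω) => (∑ j ∈ Finset.range n, X j ω ^ 2) / (n : ℝ)) atTop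
          (fun _ => (1 : ℝ)) →
        ∃ ε : ℕ × ℕ → ℝ, Tendsto ε sparseRange (𝓝 0) ∧
          ∀ n k : ℕ, 1 ≤ k → k ≤ n → ∀ δ : ℝ, 0 < δ →
            sliceMeasure n k {τ | ¬ levyDist (sumCDF P X τ) stdNormalCDF < δ + ε (n, k)} ≤
              C * (k : ℝ) ^ (3 / 4 : ℝ) * Real.exp (-c * (k : ℝ) * δ ^ 8) := by
  obtain ⟨c, hc, hmain⟩ := exists_sliceMeasure_levyDist_le
  -- The summand 10 serves the main estimate; `exp c` makes the bound at least 1 when `k δ⁸ ≤ 1`.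
  refine ⟨10 + Real.exp c, c, by positivity, hc, ?_⟩
  intro Ω _ P _ X hXm hX3 hbdd _ horth hlim
  have hX : ∀ j, MemLp (X j) 2 P := by
    intro j
    have h3 : MemLp (X j) 3 P := by
      rw [← integrable_norm_rpow_iff (hXm j).aestronglyMeasurable (by norm_num) (by norm_num)]
      refine (hX3 j).congr (ae_of_all _ fun ω => ?_)
      change |X j ω| ^ 3 = |X j ω| ^ (3 : ENNReal).toReal
      rw [ENNReal.toReal_ofNat, Real.rpow_ofNat]
    exact h3.mono_exponent (by norm_num)
  refine ⟨avgNormalDist P X, tendsto_avgNormalDist (tendsto_avgCDF hXm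
    (tendsto_charFun_avgLaw hX hX3 hbdd horth hlim)), ?_⟩
  intro n k hk hkn δ hδ
  have hk1 : (1 : ℝ) ≤ k := by exact_mod_cast hk
  have hkpow : (1 : ℝ) ≤ (k : ℝ) ^ (3 / 4 : ℝ) := Real.one_le_rpow hk1 (by norm_num)
  -- The Lévy distance is at most 1, so nothing is exceptional when `δ > 1`.
  rcases lt_or_ge 1 δ with hδ1 | hδ1
  · refine (sliceMeasure_le_of_subset hkn (A := ∅) (fun t _ hbad => absurd ?_ hbad)
      (q := 0) (by simp)).trans (by positivity)
    have := levyDist_stdNormalCDF_le zero_le_one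
      (abs_sub_stdNormalCDF_le_one (sumCDF_nonneg (P := P) X t) (sumCDF_le_one X t))
    linarith [avgNormalDist_nonneg (P := P) X n k]
  rcases le_or_gt ((k : ℝ) * δ ^ 8) 1 with hsmall | hbig
  · refine (sliceMeasure_le_one hkn _).trans ?_
    have h1 : Real.exp (-c) ≤ Real.exp (-c * k * δ ^ 8) := by
      rw [Real.exp_le_exp, mul_assoc]
      have := mul_le_mul_of_nonneg_left hsmall hc.le
      linarith
    calc (1 : ℝ) = Real.exp c * 1 * Real.exp (-c) := by rw [mul_one, ← Real.exp_add]; simp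
      _ ≤ (10 + Real.exp c) * (k : ℝ) ^ (3 / 4 : ℝ) * Real.exp (-c * k * δ ^ 8) := by
        gcongr
        linarith
  · refine (hmain hX horth hk hkn hδ hδ1).trans ?_
    have h1 : Real.exp (-(c * k * δ ^ 6)) ≤ Real.exp (-c * k * δ ^ 8) := by
      rw [Real.exp_le_exp]
      have h2 : δ ^ 8 ≤ δ ^ 6 := pow_le_pow_of_le_one hδ.le hδ1 (by norm_num)
      have h3 : c * k * δ ^ 8 ≤ c * k * δ ^ 6 := by gcongr
      linarith
    have h4 := inv_le_rpow_of_one_le hδ hδ1 hbig.le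
    have h5 : 10 / δ ≤ (10 + Real.exp c) * (k : ℝ) ^ (3 / 4 : ℝ) := by
      have e1 : 10 / δ = 10 * (1 / δ) := by ring
      rw [e1]
      gcongr
      linarith [Real.exp_pos c]
    gcongr
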